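/- Multigraphs are finite; parallel edges and loops are allowed, and a loop has its vertex as its only end. For a multigraph $F$, the degree of a vertex is the number of edges incident with it, counted with multiplicity (loops counted twice), and $\Delta(F)$ is the maximum degree. A strong edge-colouring of $F$ is an assignment of colours to the edges such that any two distinct edges that share an end, or that have an edge between them (an edge with one end in each of the two), receive distinct colours; the strong chromatic index $\chi_s'(F)$ is the least number of colours in a strong edge-colouring of $F$. The line graph $L(F)$ is the simple graph whose vertices are the edges of $F$, two distinct edges being adjacent if they share an end. For a simple graph $G$, $\omega(G)$ is its clique number, $\chi(G)$ its chromatic number, and $G^2$ is the graph formed from $G$ by adding an edge between any two distinct vertices that are connected by a two-edge path in $G$. **Theorem.** (i) There are absolute constants $\varepsilon>0$ and $\Delta_0$ such that $\chi_s'(F)\le(2-\varepsilon)\,\Delta(F)^2$ for every multigraph $F$ with $\Delta(F)\ge\Delta_0$. (ii) There is an absolute constant $\varepsilon>0$ such that $\chi(G^2)\le(2-\varepsilon)\,\omega(G)^2$ for every graph $G$ that is the line graph of a multigraph. -/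

import Mathlib

namespace SimpleGraph

/-- The square `G²`: add to `G` an edge between any two distinct vertices that are joined by a
two-edge path. -/
def square {W : Type*} (G : SimpleGraph W) : SimpleGraph W where
  Adj u v := u ≠ v ∧ (G.Adj u v ∨ ∃ w, G.Adj u w ∧ G.Adj w v)
  symm := ⟨fun _ _ h => ⟨h.1.symm, h.2.elim (fun h => Or.inl h.symm)
    fun ⟨w, h₁, h₂⟩ => Or.inr ⟨w, h₂.symm, h₁.symm⟩⟩⟩

end SimpleGraph

namespace Graph

variable {V E : Type*}

/-- Two edges of a multigraph meet if they have a common end. -/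
def EdgesMeet (F : Graph V E) (e f : E) : Prop := ∃ x, F.Inc e x ∧ F.Inc f x

/-- There is an edge between `e` and `f`: some edge has one of its ends in `e` and the other
in `f`. -/
def EdgesJoined (F : Graph V E) (e f : E) : Prop := ∃ x y, F.Inc e x ∧ F.Inc f y ∧ F.Adj x y

/-- The line graph `L(F)` of a multigraph: its vertices are the edges of `F` (parallel edges are
different vertices), and two different edges are adjacent if they have a common end. -/
def lineGraph (F : Graph V E) : SimpleGraph F.edgeSet where
  Adj e f := e ≠ f ∧ F.EdgesMeet e f
  symm := ⟨fun _ _ ⟨hne, x, he, hf⟩ => ⟨hne.symm, x, hf, he⟩⟩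

/-- The degree of a vertex: the number of edges at it, with multiplicity, where loops count
twice. (Only used for multigraphs with finitely many edges.) -/
noncomputable def degree (F : Graph V E) (v : V) : ℕ :=
  (F.incidenceSet v).ncard + (F.loopSet v).ncard

/-- The maximum degree `Δ(F)` of a finite multigraph (`0` if there are no vertices). -/
noncomputable def maxDegree (F : Graph V E) : ℕ := sSup (F.degree '' F.vertexSet)

/-- A strong edge-colouring: a proper edge-colouring in which, moreover, any two different edges
with an edge between them have different colours. -/
def IsStrongEdgeColoring (F : Graph V E) {C : Type*} (c : F.edgeSet → C) : Prop :=
  (∀ e f : F.edgeSet, e ≠ f → F.EdgesMeet e f → c e ≠ c f) ∧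
  (∀ e f : F.edgeSet, e ≠ f → F.EdgesJoined e f → c e ≠ c f)

/-- The strong chromatic index `χ'ₛ(F)`: the least number of colours in a strong edge-colouring
(`⊤` if no finite number of colours suffices). -/
noncomputable def strongChromaticIndex (F : Graph V E) : ℕ∞ :=
  ⨅ k ∈ {k : ℕ | ∃ c : F.edgeSet → Fin k, F.IsStrongEdgeColoring c}, (k : ℕ∞)

end Graph

/-!
Both assertions are about colourings of one and the same graph, the conflict graph of a
multigraph: two different edges are in conflict if some edge, possibly one of the two, shares an
end with both. This is the conflict relation of a strong edge-colouring, and it is adjacency in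
the square of the line graph. Let every vertex be an end of at most `D` edges. For the strong
chromatic index one takes `D = Δ`, and for the square of the line graph `D = ω`, as the edges at a
vertex form a clique of the line graph. A loop may be replaced by an edge to a new vertex of its
own (`Graph.unloop`) without changing the conflicts or increasing the bound `D`.

Each edge is in conflict with at most `2 D (D - 1)` edges, so greedy colouring uses at most
`2 D² - 2 D + 1` colours. This settles the second assertion for bounded `ω`. For large `D`, a positive
proportion of the colours is saved, by the method of Molloy and Reed, which has two parts.

*Neighbourhoods in the conflict graph are sparse*
(`LooplessMultigraph.le_card_nonadjPairs_conflict`). Suppose `e` is in conflict with almost `2 D²`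
edges. Let `A` be the set of neighbours of the ends of `e`, and `B` the set of the remaining
vertices. Then `A` has at most `2 D` vertices and spans few edges, so almost all edges in conflict
with `e` run between `A` and `B`. For `b ∈ B` let `s` be the number of edges from `b` to `A`, let
`n` be the number of neighbours of `b` in `A` and let `t ≤ D - s` be the number of its neighbours
in `B`. Up to lower order terms, the number of ordered pairs of edges in conflict is at most
`∑ (s² t + 2 D s n) - C`, where `C` counts the pairs `ab`, `a'b'` that are joined both by `ab'` and
by `a'b`. Counting common neighbours gives `C ≥ Q² / (4 D²)` with `Q = ∑ n²`, and
`2 D s n + s² (D - s) ≤ D² s + D n²`. As `∑ s ≤ 2 D²`, the total is at most `2 D⁴ + D Q - Q² / (4 D²) ≤ 3 D⁴`,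
while there are about `4 D⁴` pairs.

*Sparse neighbourhoods save colours*
(`SparseColoring.exists_forall_colorable_of_sparse_neighborhoods`). In a graph of maximum degree
at most `d`, colour all vertices uniformly at random and uncolour those that share their colour
with a neighbour. The partial colouring extends greedily if around every vertex of nearly full
degree linearly many colours are repeated. The expected number of repeated colours is linear in
`d`, because each of the `Ω(d²)` nonadjacent pairs of neighbours keeps a common colour with
probability `Ω(1/d)`. For concentration, the colours outside the neighbourhood are exposed first:
each of the numbers involved then depends on `O(d)` coordinates with bounded differences, and
McDiarmid's inequality (`FiniteProbability.prob_le_expect_sub_le`) applies. The Lovász local lemma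
(`FiniteProbability.exists_notMem_of_local`) finishes the argument.
-/

open Finset
open scoped BigOperators

set_option linter.unusedSectionVars false

/-! ### Uniform probability on finite product spaces -/

namespace FiniteProbability

section Prob

variable {Ω : Type*} [Fintype Ω]

/-- The probability of an event under the uniform distribution on a finite type. -/
noncomputable def prob (A : Set Ω) : ℝ := 𝔼 ω, A.indicator (fun _ => (1 : ℝ)) ω

lemma prob_nonneg (A : Set Ω) : 0 ≤ prob A :=
  expect_nonneg fun _ _ => Set.indicator_nonneg (fun _ _ => zero_le_one) _

lemma prob_mono {A B : Set Ω} (h : A ⊆ B) : prob A ≤ prob B :=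
  expect_le_expect fun _ _ => Set.indicator_le_indicator_of_subset h (fun _ => zero_le_one) _

lemma prob_univ [Nonempty Ω] : prob (Set.univ : Set Ω) = 1 := by
  simp [prob]

lemma prob_iUnion_le {ι : Type*} (s : Finset ι) (A : ι → Set Ω) :
    prob (⋃ i ∈ s, A i) ≤ ∑ i ∈ s, prob (A i) := by
  simp only [prob]
  rw [← expect_sum_comm]
  refine expect_le_expect fun ω _ => ?_
  by_cases h : ω ∈ ⋃ i ∈ s, A i
  · simp only [Set.mem_iUnion] at h
    obtain ⟨i, hi, hω⟩ := h
    have h1 : (A i).indicator (fun _ => (1 : ℝ)) ω ≤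
        ∑ i ∈ s, (A i).indicator (fun _ => (1 : ℝ)) ω :=
      single_le_sum (f := fun i => (A i).indicator (fun _ => (1 : ℝ)) ω)
        (fun j _ => Set.indicator_nonneg (fun _ _ => zero_le_one) _) hi
    have h2 : ω ∈ ⋃ i ∈ s, A i := by simp only [Set.mem_iUnion]; exact ⟨i, hi, hω⟩
    rw [Set.indicator_of_mem hω] at h1
    rwa [Set.indicator_of_mem h2]
  · rw [Set.indicator_of_notMem h]
    exact sum_nonneg fun j _ => Set.indicator_nonneg (fun _ _ => zero_le_one) _

lemma prob_inter_add_prob_diff (A B : Set Ω) : prob (A ∩ B) + prob (A \ B) = prob A := by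
  simp only [prob]
  rw [← expect_add_distrib]
  refine expect_congr rfl fun ω _ => ?_
  by_cases hA : ω ∈ A <;> by_cases hB : ω ∈ B <;> simp [hA, hB]

lemma nonempty_of_prob_pos {A : Set Ω} (h : 0 < prob A) : A.Nonempty := by
  by_contra hA
  rw [Set.not_nonempty_iff_eq_empty] at hA
  simp [prob, hA] at h

end Prob

section Product

variable {ι κ : Type*} [Fintype ι] [DecidableEq ι] [Fintype κ]

/-- Resampling the coordinates in `S` independently does not change the uniform distribution. -/
lemma expect_expect_piecewise [Nonempty κ] (S : Finset ι) (h : (ι → κ) → ℝ) :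
    𝔼 σ, 𝔼 ρ, h (S.piecewise ρ σ) = 𝔼 σ, h σ := by
  let swap : (ι → κ) × (ι → κ) → (ι → κ) × (ι → κ) :=
    fun p => (S.piecewise p.2 p.1, S.piecewise p.1 p.2)
  have hs : Function.Involutive swap := by
    rintro ⟨σ, ρ⟩
    ext i <;> by_cases hi : i ∈ S <;> simp [swap, hi]
  have h1 : 𝔼 σ, 𝔼 ρ, h (S.piecewise ρ σ) = 𝔼 p : (ι → κ) × (ι → κ), h (swap p).1 := by
    rw [← univ_product_univ, expect_product]
  have h2 : 𝔼 p : (ι → κ) × (ι → κ), h (swap p).1 = 𝔼 p : (ι → κ) × (ι → κ), h p.1 :=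
    Fintype.expect_equiv hs.toPerm _ _ fun p => rfl
  have h3 : 𝔼 p : (ι → κ) × (ι → κ), h p.1 = 𝔼 σ, 𝔼 _ρ : ι → κ, h σ := by
    rw [← univ_product_univ, expect_product]
  rw [h1, h2, h3]
  exact expect_congr rfl fun σ _ => Fintype.expect_const _

lemma expect_expect_update [Nonempty κ] (i : ι) (h : (ι → κ) → ℝ) :
    𝔼 σ, 𝔼 a, h (Function.update σ i a) = 𝔼 σ, h σ := by
  let swap : (ι → κ) × κ → (ι → κ) × κ := fun p => (Function.update p.1 i p.2, p.1 i)
  have hs : Function.Involutive swap := by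
    rintro ⟨σ, a⟩
    simp [swap]
  have h1 : 𝔼 σ, 𝔼 a, h (Function.update σ i a) = 𝔼 p : (ι → κ) × κ, h (swap p).1 := by
    rw [← univ_product_univ, expect_product]
  have h2 : 𝔼 p : (ι → κ) × κ, h (swap p).1 = 𝔼 p : (ι → κ) × κ, h p.1 :=
    Fintype.expect_equiv hs.toPerm _ _ fun p => rfl
  have h3 : 𝔼 p : (ι → κ) × κ, h p.1 = 𝔼 σ, 𝔼 _a : κ, h σ := by
    rw [← univ_product_univ, expect_product]
  rw [h1, h2, h3]
  exact expect_congr rfl fun σ _ => Fintype.expect_const _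

/-- Functions of disjoint sets of coordinates are uncorrelated. -/
lemma expect_mul_of_dependsOn [Nonempty κ] {S : Finset ι} {f g : (ι → κ) → ℝ}
    (hf : DependsOn f (S : Set ι)) (hg : DependsOn g (S : Set ι)ᶜ) :
    𝔼 σ, f σ * g σ = (𝔼 σ, f σ) * 𝔼 σ, g σ := by
  rw [← expect_expect_piecewise S, Fintype.expect_mul_expect, expect_comm]
  refine expect_congr rfl fun σ _ => expect_congr rfl fun ρ _ => ?_
  rw [hf (x := S.piecewise σ ρ) (y := σ), hg (x := S.piecewise σ ρ) (y := ρ)]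
  · intro i hi
    exact S.piecewise_eq_of_notMem _ _ (by simpa using hi)
  · intro i hi
    exact S.piecewise_eq_of_mem _ _ (by simpa using hi)

lemma prob_pi [Nonempty κ] (t : ι → Finset κ) :
    prob {σ : ι → κ | ∀ i, σ i ∈ t i} = ∏ i, ((t i).card : ℝ) / Fintype.card κ := by
  classical
  have h : {σ : ι → κ | ∀ i, σ i ∈ t i} = (Fintype.piFinset t : Set (ι → κ)) := by
    ext σ; simp
  rw [prob, h, Fintype.expect_eq_sum_div_card]
  simp only [Set.indicator_apply, mem_coe]
  rw [sum_ite_mem, univ_inter, sum_const, nsmul_eq_mul, mul_one, Fintype.card_piFinset,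
    prod_div_distrib, prod_const, card_univ, Fintype.card_fun]
  push_cast
  rfl

/-- Hoeffding's lemma, with a weaker constant: a variable whose values differ by at most `c` has a
sub-Gaussian moment generating function. -/
lemma expect_exp_le_of_abs_sub_le [Nonempty κ] (y : κ → ℝ) (c l : ℝ)
    (h : ∀ a b, |y a - y b| ≤ c) :
    𝔼 a, Real.exp (l * (y a - 𝔼 b, y b)) ≤ Real.exp (l ^ 2 * c ^ 2 / 2) := by
  have hc : 0 ≤ c := by
    obtain ⟨a⟩ := ‹Nonempty κ›
    simpa using h a a
  have hdev : ∀ a, |y a - 𝔼 b, y b| ≤ c := by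
    intro a
    have h1 : y a - 𝔼 b, y b = 𝔼 b, (y a - y b) := by
      rw [expect_sub_distrib, Fintype.expect_const]
    rw [h1, abs_le]
    constructor
    · rw [← Fintype.expect_const (ι := κ) (-c)]
      exact expect_le_expect fun b _ => (abs_le.mp (h a b)).1
    · rw [← Fintype.expect_const (ι := κ) c]
      exact expect_le_expect fun b _ => (abs_le.mp (h a b)).2
  have hmean : 𝔼 a, (y a - 𝔼 b, y b) = 0 := by
    rw [expect_sub_distrib, Fintype.expect_const, sub_self]
  rcases hc.eq_or_lt with rfl | hc
  · have h0 : ∀ a, y a - 𝔼 b, y b = 0 := fun a => abs_nonpos_iff.mp (hdev a)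
    simp [h0]
  -- The chord of `exp` over `[-l c, l c]` lies above its graph, and its slope averages out.
  have hchord : ∀ z, |z| ≤ c → Real.exp (l * z) ≤
      Real.cosh (l * c) + z * (Real.sinh (l * c) / c) := by
    intro z hz
    have hz' := abs_le.mp hz
    have hconv := convexOn_exp.2 (Set.mem_univ (-(l * c))) (Set.mem_univ (l * c))
      (show 0 ≤ (c - z) / (2 * c) from div_nonneg (by linarith) (by linarith))
      (show 0 ≤ (c + z) / (2 * c) from div_nonneg (by linarith) (by linarith))
      (by field_simp; ring)
    simp only [smul_eq_mul] at hconv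
    have e1 : (c - z) / (2 * c) * -(l * c) + (c + z) / (2 * c) * (l * c) = l * z := by
      field_simp; ring
    rw [e1] at hconv
    refine hconv.trans_eq ?_
    rw [Real.cosh_eq, Real.sinh_eq]
    field_simp
    ring
  calc 𝔼 a, Real.exp (l * (y a - 𝔼 b, y b))
      ≤ 𝔼 a, (Real.cosh (l * c) + (y a - 𝔼 b, y b) * (Real.sinh (l * c) / c)) :=
        expect_le_expect fun a _ => hchord _ (hdev a)
    _ = Real.cosh (l * c) := by
        rw [expect_add_distrib, Fintype.expect_const, ← expect_mul, hmean]
        ring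
    _ ≤ Real.exp ((l * c) ^ 2 / 2) := Real.cosh_le_exp_half_sq _
    _ = _ := by rw [mul_pow]

/-- McDiarmid's inequality for moment generating functions: averaging over one coordinate at a
time replaces the function by one with the same bounded differences in the other coordinates. -/
lemma expect_exp_le_of_bounded_differences [Nonempty κ] (c : ι → ℝ) (l : ℝ) (S : Finset ι) :
    ∀ f : (ι → κ) → ℝ, DependsOn f (S : Set ι) →
      (∀ i σ a, |f (Function.update σ i a) - f σ| ≤ c i) →
      𝔼 σ, Real.exp (l * (f σ - 𝔼 τ, f τ)) ≤ Real.exp (l ^ 2 * (∑ i ∈ S, c i ^ 2) / 2) := by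
  induction S using Finset.induction_on with
  | empty =>
    intro f hf _
    have h0 : ∀ σ, f σ - 𝔼 τ, f τ = 0 := by
      intro σ
      rw [sub_eq_zero, ← Fintype.expect_const (ι := ι → κ) (f σ)]
      exact expect_congr rfl fun τ _ => hf fun i hi => by simp at hi
    simp [h0]
  | insert i S hi ih =>
    intro f hf hd
    set g : (ι → κ) → ℝ := fun σ => 𝔼 a, f (Function.update σ i a) with hg
    have hgS : DependsOn g (S : Set ι) := by
      intro σ τ hστ
      refine expect_congr rfl fun a _ => hf fun j hj => ?_
      by_cases hji : j = i
      · subst hji; simp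
      · have : j ∈ (S : Set ι) := by simpa [hji] using hj
        simp [hji, hστ j this]
    have hgd : ∀ j σ a, |g (Function.update σ j a) - g σ| ≤ c j := by
      intro j σ b
      have hdiff : g (Function.update σ j b) - g σ =
          𝔼 a, (f (Function.update (Function.update σ j b) i a) - f (Function.update σ i a)) := by
        rw [expect_sub_distrib]
      rw [hdiff]
      have hpt : ∀ a, |f (Function.update (Function.update σ j b) i a) -
          f (Function.update σ i a)| ≤ c j := by
        intro a
        by_cases hji : j = i
        · subst hji
          simpa using (abs_nonneg _).trans (hd j σ b)
        · rw [Function.update_comm hji]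
          exact hd j _ b
      rw [abs_le]
      constructor
      · rw [← Fintype.expect_const (ι := κ) (-c j)]
        exact expect_le_expect fun a _ => (abs_le.mp (hpt a)).1
      · rw [← Fintype.expect_const (ι := κ) (c j)]
        exact expect_le_expect fun a _ => (abs_le.mp (hpt a)).2
    have hmean : 𝔼 τ, g τ = 𝔼 τ, f τ := expect_expect_update i f
    have hgupd : ∀ σ a, g (Function.update σ i a) = g σ := by
      intro σ a
      simp [hg]
    have hstep : ∀ σ, 𝔼 a, Real.exp (l * (f (Function.update σ i a) - 𝔼 τ, f τ)) ≤
        Real.exp (l ^ 2 * c i ^ 2 / 2) * Real.exp (l * (g σ - 𝔼 τ, g τ)) := by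
      intro σ
      have h1 := expect_exp_le_of_abs_sub_le (fun a => f (Function.update σ i a)) (c i) l
        (fun a b => by
          have := hd i (Function.update σ i b) a
          rwa [Function.update_idem] at this)
      calc 𝔼 a, Real.exp (l * (f (Function.update σ i a) - 𝔼 τ, f τ))
          = (𝔼 a, Real.exp (l * (f (Function.update σ i a) - g σ))) *
              Real.exp (l * (g σ - 𝔼 τ, g τ)) := by
            rw [expect_mul]
            refine expect_congr rfl fun a _ => ?_
            rw [← Real.exp_add, hmean]
            congr 1
            ring
        _ ≤ _ := mul_le_mul_of_nonneg_right h1 (Real.exp_pos _).le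
    calc 𝔼 σ, Real.exp (l * (f σ - 𝔼 τ, f τ))
        = 𝔼 σ, 𝔼 a, Real.exp (l * (f (Function.update σ i a) - 𝔼 τ, f τ)) :=
          (expect_expect_update i fun σ => Real.exp (l * (f σ - 𝔼 τ, f τ))).symm
      _ ≤ 𝔼 σ, Real.exp (l ^ 2 * c i ^ 2 / 2) * Real.exp (l * (g σ - 𝔼 τ, g τ)) :=
          expect_le_expect fun σ _ => hstep σ
      _ = Real.exp (l ^ 2 * c i ^ 2 / 2) * 𝔼 σ, Real.exp (l * (g σ - 𝔼 τ, g τ)) :=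
          (mul_expect _ _ _).symm
      _ ≤ Real.exp (l ^ 2 * c i ^ 2 / 2) * Real.exp (l ^ 2 * (∑ i ∈ S, c i ^ 2) / 2) :=
          mul_le_mul_of_nonneg_left (ih g hgS hgd) (Real.exp_pos _).le
      _ = _ := by
          rw [← Real.exp_add, sum_insert hi]
          congr 1
          ring

/-- The lower tail in McDiarmid's inequality. -/
lemma prob_le_expect_sub_le [Nonempty κ] {f : (ι → κ) → ℝ} {c : ℝ} {S : Finset ι} {C m t : ℝ}
    (hf : DependsOn f (S : Set ι)) (hd : ∀ i σ a, |f (Function.update σ i a) - f σ| ≤ c)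
    (hC : 0 < C) (hSC : S.card * c ^ 2 ≤ C) (ht : 0 ≤ t) (hm : m + t ≤ 𝔼 σ, f σ) :
    prob {σ | f σ < m} ≤ Real.exp (-(t ^ 2 / (2 * C))) := by
  -- The parameter that minimizes the exponent `l t + l² C / 2` of the Chernoff bound.
  set l : ℝ := -(t / C) with hl
  have hl0 : l ≤ 0 := by rw [hl]; exact neg_nonpos.mpr (div_nonneg ht hC.le)
  have h1 := expect_exp_le_of_bounded_differences (fun _ => c) l S f hf hd
  have h2 : prob {σ | f σ < m} ≤ 𝔼 σ, Real.exp (l * t) * Real.exp (l * (f σ - 𝔼 τ, f τ)) := by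
    refine expect_le_expect fun σ _ => ?_
    by_cases hσ : σ ∈ {σ | f σ < m}
    · rw [Set.indicator_of_mem hσ, ← Real.exp_add]
      refine Real.one_le_exp ?_
      have hσ' : f σ < m := hσ
      have : l * t + l * (f σ - 𝔼 τ, f τ) = l * (f σ + t - 𝔼 τ, f τ) := by ring
      rw [this]
      exact mul_nonneg_of_nonpos_of_nonpos hl0 (by linarith)
    · rw [Set.indicator_of_notMem hσ]
      positivity
  refine h2.trans ?_
  rw [← mul_expect]
  refine (mul_le_mul_of_nonneg_left h1 (Real.exp_pos _).le).trans ?_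
  rw [← Real.exp_add]
  refine Real.exp_le_exp.mpr ?_
  rw [sum_const, nsmul_eq_mul]
  have h3 : l ^ 2 * (S.card * c ^ 2) / 2 ≤ l ^ 2 * C / 2 := by
    have := mul_le_mul_of_nonneg_left hSC (sq_nonneg l)
    linarith
  have h4 : l * t + l ^ 2 * C / 2 = -(t ^ 2 / (2 * C)) := by
    rw [hl]; field_simp; ring
  linarith

lemma prob_inter_of_dependsOn [Nonempty κ] {S : Finset ι} {A B : Set (ι → κ)}
    (hA : DependsOn (· ∈ A) (S : Set ι)) (hB : DependsOn (· ∈ B) (S : Set ι)ᶜ) :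
    prob (A ∩ B) = prob A * prob B := by
  have h := expect_mul_of_dependsOn (S := S) (f := A.indicator fun _ => (1 : ℝ))
    (g := B.indicator fun _ => (1 : ℝ))
    (fun x y hxy => by
      have := hA hxy
      by_cases hx : x ∈ A <;> simp_all)
    (fun x y hxy => by
      have := hB hxy
      by_cases hx : x ∈ B <;> simp_all)
  rw [prob, prob, prob, ← h]
  refine expect_congr rfl fun σ _ => ?_
  by_cases h1 : σ ∈ A <;> by_cases h2 : σ ∈ B <;> simp [h1, h2]

/-- The symmetric Lovász local lemma for events that depend on few coordinates of a uniformly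
random function. -/
theorem exists_notMem_of_local [Nonempty κ] {J : Type*} [Fintype J] [DecidableEq J]
    (A : J → Set (ι → κ)) (b : J → Finset ι) (p : ℝ) (m : ℕ)
    (hA : ∀ j, DependsOn (· ∈ A j) (b j : Set ι)) (hp : ∀ j, prob (A j) ≤ p)
    (hm : ∀ j, #{k | ¬ Disjoint (b j) (b k)} ≤ m) (hm0 : 1 ≤ m) (hpm : 4 * p * m ≤ 1) :
    ∃ σ, ∀ j, σ ∉ A j := by
  rcases isEmpty_or_nonempty J with hJ | ⟨⟨j₀⟩⟩
  · exact ⟨fun _ => Classical.arbitrary κ, fun j => (hJ.false j).elim⟩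
  have hp0 : 0 ≤ p := (prob_nonneg _).trans (hp j₀)
  have hp4 : 4 * p ≤ 1 := by
    have : (1 : ℝ) ≤ m := by exact_mod_cast hm0
    nlinarith
  let good : Finset J → Set (ι → κ) := fun T => {σ | ∀ j ∈ T, σ ∉ A j}
  have hanti : ∀ {T U : Finset J}, T ⊆ U → good U ⊆ good T := fun h σ hσ j hj => hσ j (h hj)
  have key : ∀ n : ℕ, ∀ T : Finset J, T.card = n → ∀ j ∉ T,
      prob (A j ∩ good T) ≤ 2 * p * prob (good T) := by
    intro n
    induction n using Nat.strong_induction_on with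
    | _ n ih =>
      intro T hT j hj
      set T₁ := T.filter fun k => ¬ Disjoint (b j) (b k) with hT₁
      set T₂ := T.filter fun k => Disjoint (b j) (b k) with hT₂
      have hsplit : prob (A j ∩ good T) ≤ p * prob (good T₂) := by
        calc prob (A j ∩ good T) ≤ prob (A j ∩ good T₂) :=
              prob_mono (Set.inter_subset_inter_right _ (hanti (filter_subset _ _)))
          _ = prob (A j) * prob (good T₂) := by
              refine prob_inter_of_dependsOn (hA j) ?_
              intro σ τ hστ
              have : ∀ k ∈ T₂, (σ ∈ A k) = (τ ∈ A k) := by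
                intro k hk
                refine hA k fun i hi => hστ i ?_
                have hd := (mem_filter.mp hk).2
                intro hij
                exact Finset.disjoint_left.mp hd hij hi
              simp only [good, Set.mem_ofPred_eq, eq_iff_iff]
              exact forall₂_congr fun k hk => by rw [this k hk]
          _ ≤ p * prob (good T₂) := mul_le_mul_of_nonneg_right (hp j) (prob_nonneg _)
      rcases T₁.eq_empty_or_nonempty with h0 | h0
      · have : T₂ = T := by
          rw [hT₂, filter_eq_self]
          intro k hk
          by_contra hk'
          have : k ∈ T₁ := mem_filter.mpr ⟨hk, hk'⟩
          simp [h0] at this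
        rw [this] at hsplit
        nlinarith [prob_nonneg (good T)]
      · have hlt : T₂.card < n := by
          have := card_filter_add_card_filter_not (s := T) (fun k => Disjoint (b j) (b k))
          have h1 := h0.card_pos
          rw [hT₁] at h1
          rw [hT₂]
          omega
        have hdiff : good T₂ \ good T ⊆ ⋃ k ∈ T₁, A k ∩ good T₂ := by
          intro σ hσ
          have h2 := hσ.2
          simp only [good, Set.mem_ofPred_eq, not_forall, not_not] at h2
          obtain ⟨k, hk, hσk⟩ := h2
          simp only [Set.mem_iUnion]
          refine ⟨k, mem_filter.mpr ⟨hk, fun hd => ?_⟩, hσk, hσ.1⟩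
          exact hσ.1 k (mem_filter.mpr ⟨hk, hd⟩) hσk
        have hloss : prob (good T₂ \ good T) ≤ m * (2 * p * prob (good T₂)) := by
          calc prob (good T₂ \ good T) ≤ prob (⋃ k ∈ T₁, A k ∩ good T₂) := prob_mono hdiff
            _ ≤ ∑ k ∈ T₁, prob (A k ∩ good T₂) := prob_iUnion_le _ _
            _ ≤ ∑ _k ∈ T₁, 2 * p * prob (good T₂) := by
                refine sum_le_sum fun k hk => ih _ hlt T₂ rfl k fun hk₂ => ?_
                exact (mem_filter.mp hk).2 (mem_filter.mp hk₂).2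
            _ = T₁.card * (2 * p * prob (good T₂)) := by rw [sum_const, nsmul_eq_mul]
            _ ≤ _ := by
                refine mul_le_mul_of_nonneg_right ?_
                  (mul_nonneg (by linarith) (prob_nonneg _))
                have : T₁.card ≤ m :=
                  (card_le_card (filter_subset_filter _ (subset_univ T))).trans (hm j)
                exact_mod_cast this
        have hdecomp := prob_inter_add_prob_diff (good T₂) (good T)
        rw [Set.inter_eq_self_of_subset_right (hanti (filter_subset _ _))] at hdecomp
        have h5 : m * (2 * p * prob (good T₂)) ≤ prob (good T₂) / 2 := by
          nlinarith [prob_nonneg (good T₂)]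
        have h6 : prob (good T₂) ≤ 2 * prob (good T) := by linarith
        nlinarith
  have hpos : ∀ T : Finset J, 0 < prob (good T) := by
    intro T
    induction T using Finset.induction_on with
    | empty =>
      have : good ∅ = Set.univ := by ext σ; simp [good]
      rw [this, prob_univ]
      exact one_pos
    | insert j T hj ih =>
      have h1 : good (insert j T) = good T \ A j := by
        ext σ
        simp only [good, Set.mem_ofPred_eq, mem_insert, forall_eq_or_imp, Set.mem_sdiff]
        tauto
      have h2 := prob_inter_add_prob_diff (good T) (A j)
      have h3 := key _ T rfl j hj
      rw [Set.inter_comm] at h3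
      rw [h1]
      nlinarith
  obtain ⟨σ, hσ⟩ := nonempty_of_prob_pos (hpos univ)
  exact ⟨σ, fun j => hσ j (mem_univ j)⟩

end Product

end FiniteProbability

/-! ### Partial colourings and repeated colours -/

namespace SparseColoring

open FiniteProbability

section Kept

variable {V : Type*} [Fintype V] [DecidableEq V] (G : SimpleGraph V) [DecidableRel G.Adj]
  {q : ℕ}

/-- The vertices that keep their colour when, in an arbitrary assignment of colours, all vertices
with a neighbour of the same colour are uncoloured. -/
def kept (σ : V → Fin q) : Finset V := {u | ∀ z, G.Adj u z → σ z ≠ σ u}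

/-- The neighbours of `v` that keep the colour `a`. -/
def keptClass (v : V) (σ : V → Fin q) (a : Fin q) : Finset V :=
  {u ∈ G.neighborFinset v | u ∈ kept G σ ∧ σ u = a}

/-- The number of colours kept by at least two neighbours of `v`. -/
def repeats (v : V) (σ : V → Fin q) : ℕ := #{a | 2 ≤ #(keptClass G v σ a)}

/-- The coordinates that determine `repeats G v`. -/
def scope (v : V) : Finset V :=
  G.neighborFinset v ∪ (G.neighborFinset v).biUnion fun u => G.neighborFinset u

/-- The ordered pairs of distinct nonadjacent neighbours of `v`. -/
def nonadjPairs (v : V) : Finset (V × V) :=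
  {x ∈ G.neighborFinset v ×ˢ G.neighborFinset v | x.1 ≠ x.2 ∧ ¬ G.Adj x.1 x.2}

/-- The neighbours of a pair of vertices that are not neighbours of `v`. -/
def outer (v : V) (x : V × V) : Finset V :=
  (G.neighborFinset x.1 ∪ G.neighborFinset x.2) \ G.neighborFinset v

/-- The colours not used on the neighbours of the pair `x` outside the neighbourhood of `v`. -/
def avail (v : V) (x : V × V) (σ : V → Fin q) : Finset (Fin q) :=
  {a | ∀ z ∈ outer G v x, σ z ≠ a}

variable {G}

/-- Greedy completion of a partial proper colouring. -/
lemma colorable_of_partial (n : ℕ) : ∀ (U : Finset V) (σ : V → Fin q), #Uᶜ = n →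
    (∀ u ∈ U, ∀ w ∈ U, G.Adj u w → σ u ≠ σ w) →
    (∀ v ∉ U, #(G.neighborFinset v \ U) + #((G.neighborFinset v ∩ U).image σ) < q) →
    G.Colorable q := by
  induction n with
  | zero =>
    intro U σ hU hσ _
    have hU' : ∀ u, u ∈ U := fun u => by
      by_contra h
      have : u ∈ Uᶜ := mem_compl.mpr h
      simp [card_eq_zero.mp hU] at this
    exact ⟨SimpleGraph.Coloring.mk σ fun {u w} h => hσ u (hU' u) w (hU' w) h⟩
  | succ n ih =>
    intro U σ hU hσ hv
    obtain ⟨v, hvU⟩ : (Uᶜ).Nonempty := by rw [← card_pos]; omega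
    have hvU' : v ∉ U := mem_compl.mp hvU
    obtain ⟨a, ha⟩ : ∃ a, a ∉ (G.neighborFinset v ∩ U).image σ := by
      by_contra! h
      have h1 := hv v hvU'
      rw [eq_univ_iff_forall.mpr h, card_univ, Fintype.card_fin] at h1
      omega
    have hne : ∀ w ∈ U, Function.update σ v a w = σ w := fun w hw =>
      Function.update_of_ne (ne_of_mem_of_not_mem hw hvU') _ _
    have haw : ∀ w ∈ U, G.Adj v w → a ≠ σ w := fun w hw hvw h =>
      ha (mem_image.mpr ⟨w, mem_inter.mpr ⟨by simpa using hvw, hw⟩, h.symm⟩)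
    refine ih (insert v U) (Function.update σ v a) ?_ ?_ ?_
    · rw [compl_insert, card_erase_of_mem hvU]
      omega
    · intro u hu w hw huw
      rcases mem_insert.mp hu with rfl | hu' <;> rcases mem_insert.mp hw with rfl | hw'
      · exact (G.loopless.irrefl _ huw).elim
      · rw [hne w hw', Function.update_self]
        exact haw w hw' huw
      · rw [hne u hu', Function.update_self]
        exact (haw u hu' huw.symm).symm
      · rw [hne u hu', hne w hw']
        exact hσ u hu' w hw' huw
    · intro w hw
      have hwU : w ∉ U := fun h => hw (mem_insert_of_mem h)
      refine lt_of_le_of_lt ?_ (hv w hwU)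
      have himg : ((G.neighborFinset w ∩ U).image (Function.update σ v a)) =
          (G.neighborFinset w ∩ U).image σ :=
        image_congr fun z hz => hne z (mem_inter.mp hz).2
      by_cases hvw : v ∈ G.neighborFinset w
      · rw [inter_insert_of_mem hvw, image_insert, himg, sdiff_insert]
        have h1 := card_insert_le (Function.update σ v a v) ((G.neighborFinset w ∩ U).image σ)
        have h2 : v ∈ G.neighborFinset w \ U := mem_sdiff.mpr ⟨hvw, hvU'⟩
        have h3 := card_erase_add_one h2
        omega
      · rw [inter_insert_of_notMem hvw, himg]
        exact Nat.add_le_add_right (card_le_card (sdiff_subset_sdiff le_rfl (subset_insert _ _))) _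

lemma card_image_add_repeats_le (v : V) (σ : V → Fin q) :
    #((G.neighborFinset v ∩ kept G σ).image σ) + repeats G v σ ≤
      #(G.neighborFinset v ∩ kept G σ) := by
  have hclass : ∀ a, keptClass G v σ a = {u ∈ G.neighborFinset v ∩ kept G σ | σ u = a} := by
    intro a
    ext u
    simp [keptClass, and_assoc]
  rw [card_eq_sum_card_fiberwise (s := G.neighborFinset v ∩ kept G σ) (t := univ) (f := σ)
    (fun _ _ => mem_coe.mpr (mem_univ _))]
  have h1 : (G.neighborFinset v ∩ kept G σ).image σ =
      ({a | 1 ≤ #(keptClass G v σ a)} : Finset (Fin q)) := by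
    ext a
    simp only [hclass, mem_image, mem_filter, mem_univ, true_and, Nat.one_le_iff_ne_zero,
      ← Nat.pos_iff_ne_zero, card_pos]
    exact ⟨fun ⟨u, hu, h⟩ => ⟨u, mem_filter.mpr ⟨hu, h⟩⟩,
      fun ⟨u, hu⟩ => ⟨u, (mem_filter.mp hu).1, (mem_filter.mp hu).2⟩⟩
  rw [h1, repeats, card_filter, card_filter, ← sum_add_distrib]
  refine sum_le_sum fun a _ => ?_
  rw [← hclass a]
  split_ifs <;> omega

lemma keptClass_update (v z : V) (σ : V → Fin q) {a c : Fin q} (hca : c ≠ a) (hcz : c ≠ σ z) :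
    keptClass G v (Function.update σ z a) c = keptClass G v σ c := by
  have hval : ∀ w, Function.update σ z a w = c ↔ σ w = c := by
    intro w
    by_cases hw : w = z
    · subst hw
      simp [hca.symm, hcz.symm]
    · rw [Function.update_of_ne hw]
  ext u
  simp only [keptClass, kept, mem_filter, mem_univ, true_and]
  refine and_congr_right fun _ => ?_
  constructor
  · rintro ⟨h1, h2⟩
    refine ⟨fun w hw h => h1 w hw ?_, (hval u).mp h2⟩
    rw [h2, hval, h, (hval u).mp h2]
  · rintro ⟨h1, h2⟩
    refine ⟨fun w hw h => h1 w hw ?_, (hval u).mpr h2⟩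
    rw [(hval u).mpr h2, hval] at h
    rw [h, h2]

lemma repeats_update_le (v z : V) (σ : V → Fin q) (a : Fin q) :
    repeats G v (Function.update σ z a) ≤ repeats G v σ + 2 := by
  have h : ({c | 2 ≤ #(keptClass G v (Function.update σ z a) c)} : Finset (Fin q)) ⊆
      ({c | 2 ≤ #(keptClass G v σ c)} : Finset (Fin q)) ∪ {a, σ z} := by
    intro c hc
    by_cases h : c = a ∨ c = σ z
    · exact mem_union_right _ (by simpa using h)
    · rw [not_or] at h
      rw [mem_filter, keptClass_update v z σ h.1 h.2] at hc
      exact mem_union_left _ (mem_filter.mpr hc)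
  exact (card_le_card h).trans ((card_union_le _ _).trans (Nat.add_le_add_left card_le_two _))

lemma abs_repeats_update_sub_le (v z : V) (σ : V → Fin q) (a : Fin q) :
    |(repeats G v (Function.update σ z a) : ℝ) - repeats G v σ| ≤ 2 := by
  have h1 := repeats_update_le (G := G) v z σ a
  have h2 := repeats_update_le (G := G) v z (Function.update σ z a) (σ z)
  rw [Function.update_idem, Function.update_eq_self] at h2
  have h1' : (repeats G v (Function.update σ z a) : ℝ) ≤ repeats G v σ + 2 := by exact_mod_cast h1
  have h2' : (repeats G v σ : ℝ) ≤ repeats G v (Function.update σ z a) + 2 := by exact_mod_cast h2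
  rw [abs_le]
  constructor <;> linarith

lemma dependsOn_repeats (v : V) :
    DependsOn (fun σ : V → Fin q => repeats G v σ) (scope G v : Set V) := by
  intro σ τ h
  have hN : ∀ u ∈ G.neighborFinset v, σ u = τ u := fun u hu =>
    h u (mem_coe.mpr (mem_union_left _ hu))
  have hN2 : ∀ u ∈ G.neighborFinset v, ∀ w, G.Adj u w → σ w = τ w := fun u hu w hw =>
    h w (mem_coe.mpr (mem_union_right _ (mem_biUnion.mpr ⟨u, hu, by simpa using hw⟩)))
  have : ∀ a, keptClass G v σ a = keptClass G v τ a := by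
    intro a
    refine filter_congr fun u hu => ?_
    rw [hN u hu, kept, kept, mem_filter, mem_filter, hN u hu]
    refine and_congr_left fun _ => and_congr_right fun _ => forall₂_congr fun w hw => ?_
    rw [hN2 u hu w hw]
  simp only [repeats, this]

lemma mem_scope_comm {v w : V} : w ∈ scope G v ↔ v ∈ scope G w := by
  simp only [scope, mem_union, mem_biUnion, SimpleGraph.mem_neighborFinset]
  constructor <;> rintro (h | ⟨u, h1, h2⟩)
  · exact Or.inl h.symm
  · exact Or.inr ⟨u, h2.symm, h1.symm⟩
  · exact Or.inl h.symm
  · exact Or.inr ⟨u, h2.symm, h1.symm⟩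

lemma card_scope_le {d : ℕ} (hd : ∀ v, G.degree v ≤ d) (v : V) : #(scope G v) ≤ d + d * d := by
  refine (card_union_le _ _).trans (Nat.add_le_add (hd v) ?_)
  exact (card_biUnion_le_card_mul _ _ d fun u _ => hd u).trans (Nat.mul_le_mul_right _ (hd v))

lemma card_not_disjoint_scope_le {d : ℕ} (hd : ∀ v, G.degree v ≤ d) (v : V) :
    #{w | ¬ Disjoint (scope G v) (scope G w)} ≤ (d + d * d) * (d + d * d) := by
  have h : ({w | ¬ Disjoint (scope G v) (scope G w)} : Finset V) ⊆
      (scope G v).biUnion (scope G) := by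
    intro w hw
    obtain ⟨u, hu, hu'⟩ := not_disjoint_iff.mp (mem_filter.mp hw).2
    exact mem_biUnion.mpr ⟨u, hu, mem_scope_comm.mp hu'⟩
  exact (card_le_card h).trans ((card_biUnion_le_card_mul _ _ _ fun u _ =>
    card_scope_le hd u).trans (Nat.mul_le_mul_right _ (card_scope_le hd v)))

lemma dependsOn_avail (v : V) (x : V × V) :
    DependsOn (fun σ : V → Fin q => avail G v x σ) (outer G v x : Set V) := by
  intro σ τ h
  refine filter_congr fun a _ => forall₂_congr fun z hz => ?_
  rw [h z (mem_coe.mpr hz)]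

lemma card_avail_update_le (v z : V) (x : V × V) (σ : V → Fin q) (a : Fin q) :
    #(avail G v x (Function.update σ z a)) ≤ #(avail G v x σ) + 1 := by
  have h : avail G v x (Function.update σ z a) ⊆ insert (σ z) (avail G v x σ) := by
    intro c hc
    by_cases hcz : c = σ z
    · exact mem_insert.mpr (Or.inl hcz)
    · refine mem_insert_of_mem (mem_filter.mpr ⟨mem_univ _, fun w hw => ?_⟩)
      by_cases hwz : w = z
      · subst hwz; exact fun h => hcz h.symm
      · have := (mem_filter.mp hc).2 w hw
        rwa [Function.update_of_ne hwz] at this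
  exact (card_le_card h).trans (card_insert_le _ _)

lemma abs_card_avail_update_sub_le (v z : V) (x : V × V) (σ : V → Fin q) (a : Fin q) :
    |(#(avail G v x (Function.update σ z a)) : ℝ) - #(avail G v x σ)| ≤ 1 := by
  have h1 := card_avail_update_le (G := G) v z x σ a
  have h2 := card_avail_update_le (G := G) v z x (Function.update σ z a) (σ z)
  rw [Function.update_idem, Function.update_eq_self] at h2
  have h1' : (#(avail G v x (Function.update σ z a)) : ℝ) ≤ #(avail G v x σ) + 1 := by
    exact_mod_cast h1
  have h2' : (#(avail G v x σ) : ℝ) ≤ #(avail G v x (Function.update σ z a)) + 1 := by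
    exact_mod_cast h2
  rw [abs_le]
  constructor <;> linarith

lemma card_outer_le {d : ℕ} (hd : ∀ v, G.degree v ≤ d) (v : V) (x : V × V) :
    #(outer G v x) ≤ 2 * d := by
  refine (card_le_card sdiff_subset).trans ((card_union_le _ _).trans ?_)
  have h1 : #(G.neighborFinset x.1) ≤ d := hd x.1
  have h2 : #(G.neighborFinset x.2) ≤ d := hd x.2
  omega

end Kept

/-- By Bernoulli's inequality `(1 - 1 / q) ^ q ≥ 1 / 4`, so a colour avoids `O(q)` vertices with
probability bounded below. -/
lemma quarter_pow_le {q k n : ℕ} (hq : 2 ≤ q) (hn : n ≤ k * q) :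
    (1 / 4 : ℝ) ^ k ≤ (1 - 1 / q) ^ n := by
  have hq' : (2 : ℝ) ≤ q := by exact_mod_cast hq
  have hq1 : (1 / q : ℝ) ≤ 1 / 2 := one_div_le_one_div_of_le two_pos hq'
  have hq0 : (0 : ℝ) < 1 / q := by positivity
  have h0 : (0 : ℝ) ≤ 1 - 1 / q := by linarith
  have hhalf : (1 / 2 : ℝ) ≤ (1 - 1 / q : ℝ) ^ ((q : ℝ) / 2) := by
    have := one_add_mul_self_le_rpow_one_add (s := -(1 / q : ℝ)) (by linarith)
      (p := (q : ℝ) / 2) (by linarith)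
    rw [← sub_eq_add_neg] at this
    refine le_trans (le_of_eq ?_) this
    field_simp
    norm_num
  have hquarter : (1 / 4 : ℝ) ≤ (1 - 1 / q) ^ q := by
    have h1 : ((1 - 1 / q : ℝ) ^ ((q : ℝ) / 2)) ^ 2 = (1 - 1 / q) ^ q := by
      rw [← Real.rpow_natCast, ← Real.rpow_mul h0, ← Real.rpow_natCast]
      congr 1
      push_cast
      ring
    rw [← h1]
    nlinarith
  calc (1 / 4 : ℝ) ^ k ≤ ((1 - 1 / q) ^ q) ^ k := pow_le_pow_left₀ (by norm_num) hquarter k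
    _ = (1 - 1 / q) ^ (k * q) := by rw [← pow_mul, mul_comm]
    _ ≤ (1 - 1 / q) ^ n := pow_le_pow_of_le_one h0 (by linarith) hn

end SparseColoring

/-! ### Colouring graphs with sparse neighbourhoods -/

namespace SparseColoring

open FiniteProbability

section Bounds

variable {V : Type*} [Fintype V] [DecidableEq V] {G : SimpleGraph V} [DecidableRel G.Adj]
  {q d : ℕ}

/-- The colouring `ρ` uses the colour `a` in the neighbourhood of `v` exactly at the pair `x`. -/
def OnlyPair (G : SimpleGraph V) [DecidableRel G.Adj] (v : V) (x : V × V) (a : Fin q)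
    (ρ : V → Fin q) : Prop :=
  ρ x.1 = a ∧ ρ x.2 = a ∧ ∀ z ∈ G.neighborFinset v, z ≠ x.1 → z ≠ x.2 → ρ z ≠ a

instance (v : V) (x : V × V) (a : Fin q) (ρ : V → Fin q) : Decidable (OnlyPair G v x a ρ) := by
  unfold OnlyPair; infer_instance

lemma prob_onlyPair_ge (hq : 2 ≤ q) (hd2 : d ≤ 2 * q) (hd : ∀ v, G.degree v ≤ d) (v : V)
    {x : V × V} (hx : x ∈ nonadjPairs G v) (a : Fin q) :
    1 / (16 * q ^ 2 : ℝ) ≤ prob {ρ : V → Fin q | OnlyPair G v x a ρ} := by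
  have : Nonempty (Fin q) := ⟨a⟩
  simp only [nonadjPairs, mem_filter, mem_product] at hx
  obtain ⟨⟨hx1, hx2⟩, hne, -⟩ := hx
  have hq' : (2 : ℝ) ≤ q := by exact_mod_cast hq
  have hq1 : (1 / q : ℝ) ≤ 1 / 2 := one_div_le_one_div_of_le two_pos hq'
  have hq0 : (0 : ℝ) < 1 / q := by positivity
  let t : V → Finset (Fin q) := fun i =>
    if i = x.1 ∨ i = x.2 then {a} else if i ∈ G.neighborFinset v then univ.erase a else univ
  have hset : {ρ : V → Fin q | OnlyPair G v x a ρ} = {ρ | ∀ i, ρ i ∈ t i} := by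
    ext ρ
    simp only [Set.mem_ofPred_eq, OnlyPair, t]
    constructor
    · rintro ⟨h1, h2, h3⟩ i
      split_ifs with hi hi'
      · rcases hi with rfl | rfl <;> simp [h1, h2]
      · rw [not_or] at hi
        simpa using h3 i hi' hi.1 hi.2
      · exact mem_univ _
    · intro h
      refine ⟨by simpa using h x.1, by simpa using h x.2, fun z hz h1 h2 => ?_⟩
      have := h z
      rw [if_neg (by tauto), if_pos hz] at this
      exact ne_of_mem_erase this
  rw [hset, prob_pi]
  have hcard : #({x.1, x.2} : Finset V) = 2 := card_pair hne
  calc 1 / (16 * q ^ 2 : ℝ) = (1 / q) ^ #({x.1, x.2} : Finset V) * (1 / 4) ^ 2 := by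
        rw [hcard]; field_simp; norm_num
    _ ≤ (1 / q) ^ #({x.1, x.2} : Finset V) * (1 - 1 / q) ^ #(G.neighborFinset v) :=
        mul_le_mul_of_nonneg_left (quarter_pow_le hq ((hd v).trans hd2)) (by positivity)
    _ = ∏ i, ((if i ∈ ({x.1, x.2} : Finset V) then (1 / q : ℝ) else 1) *
          (if i ∈ G.neighborFinset v then (1 - 1 / q : ℝ) else 1)) := by
        rw [prod_mul_distrib, prod_ite_mem, prod_ite_mem, univ_inter, univ_inter, prod_const,
          prod_const]
    _ ≤ ∏ i, (#(t i) : ℝ) / Fintype.card (Fin q) := by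
        refine prod_le_prod (fun i _ => mul_nonneg ?_ ?_) fun i _ => ?_
        · split_ifs <;> linarith
        · split_ifs <;> linarith
        · simp only [t, mem_insert, mem_singleton, Fintype.card_fin]
          split_ifs with h1 h2 h2
          · rw [card_singleton, Nat.cast_one]
            nlinarith
          · rw [card_singleton, Nat.cast_one, mul_one]
          · rw [card_erase_of_mem (mem_univ _), card_univ, Fintype.card_fin,
              Nat.cast_sub (by omega), one_mul, sub_div, div_self (by positivity), Nat.cast_one]
          · rw [card_univ, Fintype.card_fin, div_self (by positivity), one_mul]

/-- A colour that the coloured neighbourhood of `v` uses only at a nonadjacent pair, and that does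
not occur on the other neighbours of that pair, is repeated at `v`. -/
lemma sum_card_onlyPair_le (v : V) (σ ρ : V → Fin q) :
    ∑ x ∈ nonadjPairs G v, #{a ∈ avail G v x σ | OnlyPair G v x a ρ} ≤
      2 * repeats G v ((G.neighborFinset v).piecewise ρ σ) := by
  set N := G.neighborFinset v
  set τ := N.piecewise ρ σ with hτ
  have hin : ∀ u ∈ N, τ u = ρ u := fun u hu => piecewise_eq_of_mem _ _ _ hu
  have hout : ∀ u ∉ N, τ u = σ u := fun u hu => piecewise_eq_of_notMem _ _ _ hu
  have hswap : ∑ x ∈ nonadjPairs G v, #{a ∈ avail G v x σ | OnlyPair G v x a ρ} =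
      ∑ a, #{x ∈ nonadjPairs G v | a ∈ avail G v x σ ∧ OnlyPair G v x a ρ} := by
    simp only [card_eq_sum_ones, sum_filter]
    rw [sum_comm' (s := nonadjPairs G v) (t := fun x => avail G v x σ) (t' := univ)
      (s' := fun a => {x ∈ nonadjPairs G v | a ∈ avail G v x σ}) (by simp)]
    refine sum_congr rfl fun a _ => ?_
    rw [sum_filter]
    refine sum_congr rfl fun x _ => ?_
    by_cases h1 : a ∈ avail G v x σ <;> simp [h1]
  rw [hswap, repeats, card_filter, mul_sum]
  refine sum_le_sum fun a _ => ?_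
  rcases (filter (fun x => a ∈ avail G v x σ ∧ OnlyPair G v x a ρ)
    (nonadjPairs G v)).eq_empty_or_nonempty with h | ⟨⟨u, w⟩, h⟩
  · rw [h, card_empty]; exact Nat.zero_le _
  · have hsub : filter (fun x => a ∈ avail G v x σ ∧ OnlyPair G v x a ρ) (nonadjPairs G v) ⊆
        {(u, w), (w, u)} := by
      rintro ⟨u', w'⟩ h'
      rw [mem_filter, nonadjPairs, mem_filter, mem_product] at h h'
      simp only [mem_insert, mem_singleton, Prod.mk.injEq]
      obtain ⟨⟨⟨hu', hw'⟩, hne', -⟩, -, hau', haw', -⟩ := h'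
      obtain ⟨-, -, -, -, honly⟩ := h
      have h1 : u' = u ∨ u' = w := by
        by_contra hcon
        rw [not_or] at hcon
        exact honly u' hu' hcon.1 hcon.2 hau'
      have h2 : w' = u ∨ w' = w := by
        by_contra hcon
        rw [not_or] at hcon
        exact honly w' hw' hcon.1 hcon.2 haw'
      rcases h1 with rfl | rfl <;> rcases h2 with rfl | rfl <;> simp_all
    have htwo : 2 ≤ #(keptClass G v τ a) := by
      rw [mem_filter, nonadjPairs, mem_filter, mem_product] at h
      obtain ⟨⟨⟨hu, hw⟩, hne, hnadj⟩, hav, hau, haw, honly⟩ := h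
      have hkept : ∀ y ∈ N, (y = u ∨ y = w) → ρ y = a → y ∈ keptClass G v τ a := by
        intro y hy hyuw hya
        refine mem_filter.mpr ⟨hy, mem_filter.mpr ⟨mem_univ _, fun z hz => ?_⟩,
          by rw [hin y hy, hya]⟩
        rw [hin y hy, hya]
        by_cases hzN : z ∈ N
        · rw [hin z hzN]
          refine honly z hzN ?_ ?_ <;> rintro rfl <;> rcases hyuw with rfl | rfl
          · exact G.loopless.irrefl _ hz
          · exact hnadj hz.symm
          · exact hnadj hz
          · exact G.loopless.irrefl _ hz
        · rw [hout z hzN]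
          refine (mem_filter.mp hav).2 z (mem_sdiff.mpr ⟨?_, hzN⟩)
          rcases hyuw with rfl | rfl
          · exact mem_union_left _ (by simpa using hz)
          · exact mem_union_right _ (by simpa using hz)
      rw [← card_pair hne]
      refine card_le_card fun y hy => ?_
      rcases mem_insert.mp hy with rfl | hy
      · exact hkept _ hu (Or.inl rfl) hau
      · rw [mem_singleton] at hy
        subst hy
        exact hkept _ hw (Or.inr rfl) haw
    rw [if_pos htwo]
    exact (card_le_card hsub).trans card_le_two

/-- If every nonadjacent pair of neighbours of `v` has many available colours, then recolouring
the neighbourhood of `v` at random repeats linearly many colours in expectation. There are `d² / 8`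
ordered pairs and `q / 512` colours for each, every such event has probability at least
`1 / (16 q²)`, and a repeated colour is counted at most twice. -/
lemma expect_repeats_ge (hq : 2 ≤ q) (hqd : q ≤ d) (hd2 : d ≤ 2 * q)
    (hd : ∀ v, G.degree v ≤ d) (v : V) (hv : d ^ 2 ≤ 8 * #(nonadjPairs G v)) (σ : V → Fin q)
    (hσ : ∀ x ∈ nonadjPairs G v, (q / 512 : ℝ) ≤ #(avail G v x σ)) :
    (d / 2 ^ 17 : ℝ) ≤
      𝔼 ρ : V → Fin q, (repeats G v ((G.neighborFinset v).piecewise ρ σ) : ℝ) := by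
  have : Nonempty (Fin q) := ⟨⟨0, by omega⟩⟩
  have hpt : ∀ ρ : V → Fin q, (1 / 2 : ℝ) * ∑ x ∈ nonadjPairs G v, ∑ a ∈ avail G v x σ,
      Set.indicator {ρ : V → Fin q | OnlyPair G v x a ρ} (fun _ => (1 : ℝ)) ρ ≤
      repeats G v ((G.neighborFinset v).piecewise ρ σ) := by
    intro ρ
    have h := sum_card_onlyPair_le (G := G) v σ ρ
    have h' : (∑ x ∈ nonadjPairs G v, (#{a ∈ avail G v x σ | OnlyPair G v x a ρ} : ℝ)) ≤
        2 * repeats G v ((G.neighborFinset v).piecewise ρ σ) := by exact_mod_cast h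
    have h2 : ∑ x ∈ nonadjPairs G v, ∑ a ∈ avail G v x σ,
        Set.indicator {ρ : V → Fin q | OnlyPair G v x a ρ} (fun _ => (1 : ℝ)) ρ =
        ∑ x ∈ nonadjPairs G v, (#{a ∈ avail G v x σ | OnlyPair G v x a ρ} : ℝ) := by
      refine sum_congr rfl fun x _ => ?_
      rw [card_filter, Nat.cast_sum]
      refine sum_congr rfl fun a _ => ?_
      by_cases hO : OnlyPair G v x a ρ
      · rw [if_pos hO, Set.indicator_of_mem (by exact hO), Nat.cast_one]
      · rw [if_neg hO, Set.indicator_of_notMem (by exact hO), Nat.cast_zero]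
    rw [h2]
    linarith
  refine le_trans ?_ (expect_le_expect fun ρ _ => hpt ρ)
  rw [← mul_expect, expect_sum_comm]
  simp_rw [expect_sum_comm]
  have hq0 : (0 : ℝ) < q := by exact_mod_cast (by omega : 0 < q)
  have hqd' : (q : ℝ) ≤ d := by exact_mod_cast hqd
  have hv' : (d : ℝ) ^ 2 ≤ 8 * #(nonadjPairs G v) := by exact_mod_cast hv
  have hlow : (#(nonadjPairs G v) : ℝ) * (q / 512 * (1 / (16 * q ^ 2))) ≤
      ∑ x ∈ nonadjPairs G v, ∑ a ∈ avail G v x σ,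
        prob {ρ : V → Fin q | OnlyPair G v x a ρ} := by
    rw [← nsmul_eq_mul]
    refine card_nsmul_le_sum _ _ _ fun x hx => ?_
    calc (q / 512 * (1 / (16 * q ^ 2)) : ℝ) ≤ #(avail G v x σ) * (1 / (16 * q ^ 2)) :=
          mul_le_mul_of_nonneg_right (hσ x hx) (by positivity)
      _ ≤ _ := by
          rw [← nsmul_eq_mul]
          exact card_nsmul_le_sum _ _ _ fun a _ => prob_onlyPair_ge hq hd2 hd v hx a
  have h2 : (d / 2 ^ 17 : ℝ) ≤
      1 / 2 * ((#(nonadjPairs G v) : ℝ) * (q / 512 * (1 / (16 * q ^ 2)))) := by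
    have e : 1 / 2 * ((#(nonadjPairs G v) : ℝ) * (q / 512 * (1 / (16 * q ^ 2)))) =
        #(nonadjPairs G v) / (2 ^ 14 * q) := by field_simp; ring
    rw [e, div_le_div_iff₀ (by positivity) (by positivity)]
    nlinarith
  exact h2.trans (mul_le_mul_of_nonneg_left hlow (by norm_num))

lemma prob_card_avail_lt_le (hq : 2 ≤ q) (hd2 : d ≤ 2 * q)
    (hd : ∀ v, G.degree v ≤ d) (v : V) (x : V × V) :
    prob {σ : V → Fin q | (#(avail G v x σ) : ℝ) < q / 512} ≤ Real.exp (-(d / 2 ^ 22)) := by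
  have : Nonempty (Fin q) := ⟨⟨0, by omega⟩⟩
  have hq0 : (0 : ℝ) < q := by exact_mod_cast (by omega : 0 < q)
  have hO : #(outer G v x) ≤ 4 * q := (card_outer_le hd v x).trans (by omega)
  have hmean : (q / 512 + q / 512 : ℝ) ≤ 𝔼 σ : V → Fin q, (#(avail G v x σ) : ℝ) := by
    have hcard : ∀ σ : V → Fin q, (#(avail G v x σ) : ℝ) =
        ∑ a : Fin q, Set.indicator {σ : V → Fin q | ∀ z ∈ outer G v x, σ z ≠ a}
          (fun _ => (1 : ℝ)) σ := by
      intro σ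
      rw [avail, card_filter, Nat.cast_sum]
      refine sum_congr rfl fun a _ => ?_
      by_cases h : ∀ z ∈ outer G v x, σ z ≠ a
      · rw [if_pos h, Set.indicator_of_mem (by exact h), Nat.cast_one]
      · rw [if_neg h, Set.indicator_of_notMem (by exact h), Nat.cast_zero]
    simp_rw [hcard]
    rw [expect_sum_comm]
    have hp : ∀ a : Fin q, (1 / 256 : ℝ) ≤
        prob {σ : V → Fin q | ∀ z ∈ outer G v x, σ z ≠ a} := by
      intro a
      have hset : {σ : V → Fin q | ∀ z ∈ outer G v x, σ z ≠ a} =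
          {σ | ∀ i, σ i ∈ if i ∈ outer G v x then univ.erase a else univ} := by
        ext σ
        refine forall_congr' fun i => ?_
        split_ifs with hi <;> simp [hi]
      have hprod : ∏ i, (#(if i ∈ outer G v x then univ.erase a else univ) : ℝ) /
          Fintype.card (Fin q) = (1 - 1 / q) ^ #(outer G v x) := by
        rw [← prod_const, ← univ_inter (outer G v x), ← prod_ite_mem]
        refine prod_congr rfl fun i _ => ?_
        rw [univ_inter]
        split_ifs
        · rw [card_erase_of_mem (mem_univ _), card_univ, Fintype.card_fin,
            Nat.cast_sub (by omega), sub_div, div_self hq0.ne', Nat.cast_one]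
        · rw [card_univ, Fintype.card_fin, div_self hq0.ne']
      rw [hset, prob_pi, hprod]
      refine le_trans ?_ (quarter_pow_le hq hO)
      norm_num
    calc (q / 512 + q / 512 : ℝ) = #(univ : Finset (Fin q)) • (1 / 256 : ℝ) := by
          rw [card_univ, Fintype.card_fin, nsmul_eq_mul]; ring
      _ ≤ _ := card_nsmul_le_sum _ _ _ fun a _ => hp a
  refine (prob_le_expect_sub_le (S := outer G v x) (c := 1) (C := 4 * q) (t := q / 512)
    ?_ ?_ (by positivity) ?_ (by positivity) hmean).trans ?_
  · intro σ τ h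
    exact congrArg (fun s : Finset (Fin q) => (#s : ℝ)) (dependsOn_avail v x h)
  · exact fun z σ a => abs_card_avail_update_sub_le v z x σ a
  · rw [one_pow, mul_one]
    exact_mod_cast hO
  · refine Real.exp_le_exp.mpr (neg_le_neg ?_)
    have hd2' : (d : ℝ) ≤ 2 * q := by exact_mod_cast hd2
    have e : ((q : ℝ) / 512) ^ 2 / (2 * (4 * q)) = q / 2 ^ 21 := by field_simp; norm_num
    rw [e]
    linarith

/-- Few repetitions around a vertex with a sparse neighbourhood are exponentially unlikely. The
colours outside the neighbourhood are exposed first, and concentration is applied twice: to the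
available colours of each pair, and to the number of repetitions given the outside. -/
lemma prob_repeats_lt_le (hq : 2 ≤ q) (hqd : q ≤ d) (hd2 : d ≤ 2 * q)
    (hd : ∀ v, G.degree v ≤ d) (v : V) (hv : d ^ 2 ≤ 8 * #(nonadjPairs G v)) :
    prob {σ : V → Fin q | (repeats G v σ : ℝ) < d / 2 ^ 18} ≤
      (d ^ 2 + 1) * Real.exp (-(d / 2 ^ 39)) := by
  have : Nonempty (Fin q) := ⟨⟨0, by omega⟩⟩
  have hd0 : (0 : ℝ) < d := by exact_mod_cast (by omega : 0 < d)
  set N := G.neighborFinset v with hN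
  set bad : Set (V → Fin q) :=
    ⋃ x ∈ nonadjPairs G v, {σ | (#(avail G v x σ) : ℝ) < q / 512} with hbad
  have hcond : ∀ σ : V → Fin q,
      𝔼 ρ, Set.indicator {σ : V → Fin q | (repeats G v σ : ℝ) < d / 2 ^ 18}
      (fun _ => (1 : ℝ)) (N.piecewise ρ σ) ≤
      bad.indicator (fun _ => (1 : ℝ)) σ + Real.exp (-(d / 2 ^ 39)) := by
    intro σ
    by_cases hσ : σ ∈ bad
    · rw [Set.indicator_of_mem hσ]
      have h1 : 𝔼 ρ, Set.indicator {σ : V → Fin q | (repeats G v σ : ℝ) < d / 2 ^ 18}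
          (fun _ => (1 : ℝ)) (N.piecewise ρ σ) ≤ 𝔼 _ρ : V → Fin q, (1 : ℝ) :=
        expect_le_expect fun ρ _ => Set.indicator_le_self' (fun _ _ => zero_le_one) _
      rw [Fintype.expect_const] at h1
      linarith [Real.exp_pos (-((d : ℝ) / 2 ^ 39))]
    · rw [Set.indicator_of_notMem hσ, zero_add]
      have hav : ∀ x ∈ nonadjPairs G v, (q / 512 : ℝ) ≤ #(avail G v x σ) := by
        intro x hx
        by_contra hcon
        refine hσ ?_
        simp only [hbad, Set.mem_iUnion]
        exact ⟨x, hx, not_le.mp hcon⟩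
      have hmean := expect_repeats_ge hq hqd hd2 hd v hv σ hav
      have hmean' : (d / 2 ^ 18 + d / 2 ^ 18 : ℝ) ≤
          𝔼 ρ : V → Fin q, (repeats G v (N.piecewise ρ σ) : ℝ) := by
        refine le_trans (le_of_eq ?_) hmean
        ring
      have e : ((d : ℝ) / 2 ^ 18) ^ 2 / (2 * (4 * d)) = d / 2 ^ 39 := by
        field_simp
        norm_num
      have hprob : 𝔼 ρ, Set.indicator {σ : V → Fin q | (repeats G v σ : ℝ) < d / 2 ^ 18}
          (fun _ => (1 : ℝ)) (N.piecewise ρ σ) =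
          prob {ρ : V → Fin q | (repeats G v (N.piecewise ρ σ) : ℝ) < d / 2 ^ 18} := by
        refine expect_congr rfl fun ρ _ => ?_
        by_cases h : (repeats G v (N.piecewise ρ σ) : ℝ) < d / 2 ^ 18
        · rw [Set.indicator_of_mem (by exact h), Set.indicator_of_mem (by exact h)]
        · rw [Set.indicator_of_notMem (by exact h), Set.indicator_of_notMem (by exact h)]
      rw [hprob, ← e]
      refine prob_le_expect_sub_le (S := N) (c := 2) (C := 4 * d)
        (f := fun ρ : V → Fin q => (repeats G v (N.piecewise ρ σ) : ℝ)) ?_ ?_ (by positivity) ?_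
        (by positivity) hmean'
      · intro ρ ρ' h
        have : N.piecewise ρ σ = N.piecewise ρ' σ :=
          N.piecewise_congr (fun i hi => h i hi) fun _ _ => rfl
        simp only [this]
      · intro i ρ a
        by_cases hi : i ∈ N
        · rw [← N.update_piecewise_of_mem _ _ hi]
          exact abs_repeats_update_sub_le v i _ a
        · have : N.piecewise (Function.update ρ i a) σ = N.piecewise ρ σ :=
            N.piecewise_congr (fun j hj => Function.update_of_ne (ne_of_mem_of_not_mem hj hi) _ _)
              fun _ _ => rfl
          simp [this]
      · have : (#N : ℝ) ≤ d := by exact_mod_cast hd v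
        linarith
  have hpairs : (#(nonadjPairs G v) : ℝ) ≤ d ^ 2 := by
    have h1 : #(nonadjPairs G v) ≤ #N * #N :=
      (card_le_card (filter_subset _ _)).trans (card_product _ _).le
    have h2 : #N * #N ≤ d * d := Nat.mul_le_mul (hd v) (hd v)
    rw [pow_two]
    exact_mod_cast h1.trans h2
  have hbadp : prob bad ≤ d ^ 2 * Real.exp (-(d / 2 ^ 39)) := by
    calc prob bad ≤ ∑ x ∈ nonadjPairs G v,
          prob {σ : V → Fin q | (#(avail G v x σ) : ℝ) < q / 512} := prob_iUnion_le _ _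
      _ ≤ #(nonadjPairs G v) • Real.exp (-(d / 2 ^ 39)) := by
          refine sum_le_card_nsmul _ _ _ fun x _ =>
            (prob_card_avail_lt_le hq hd2 hd v x).trans (Real.exp_le_exp.mpr ?_)
          refine neg_le_neg (div_le_div_of_nonneg_left hd0.le (by norm_num) (by norm_num))
      _ ≤ _ := by
          rw [nsmul_eq_mul]
          exact mul_le_mul_of_nonneg_right hpairs (Real.exp_pos _).le
  calc prob {σ : V → Fin q | (repeats G v σ : ℝ) < d / 2 ^ 18}
      = 𝔼 σ, 𝔼 ρ, Set.indicator {σ : V → Fin q | (repeats G v σ : ℝ) < d / 2 ^ 18}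
          (fun _ => (1 : ℝ)) (N.piecewise ρ σ) := (expect_expect_piecewise N _).symm
    _ ≤ 𝔼 σ, (bad.indicator (fun _ => (1 : ℝ)) σ + Real.exp (-(d / 2 ^ 39))) :=
        expect_le_expect fun σ _ => hcond σ
    _ = prob bad + Real.exp (-(d / 2 ^ 39)) := by
        rw [expect_add_distrib, Fintype.expect_const, prob]
    _ ≤ _ := by linarith

end Bounds

/-- For large `d`, the failure probability `(d² + 1) exp (-d / 2³⁹)` meets the condition of the
local lemma, as each event shares coordinates with at most `(d + d²)²` events. -/
lemma exists_forall_local_condition : ∃ d₀ : ℕ, 2 ≤ d₀ ∧ ∀ d : ℕ, d₀ ≤ d →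
    4 * ((d ^ 2 + 1) * Real.exp (-(d / 2 ^ 39))) * ((d + d * d) * (d + d * d) : ℕ) ≤ 1 := by
  have h := (Real.tendsto_pow_mul_exp_neg_atTop_nhds_zero 6).const_mul
    (32 * ((2 : ℝ) ^ 39) ^ 6)
  rw [mul_zero] at h
  have h2 : Filter.Tendsto (fun d : ℕ => (d : ℝ) / 2 ^ 39) Filter.atTop Filter.atTop :=
    tendsto_natCast_atTop_atTop.atTop_div_const (by positivity)
  have h3 := (h.comp h2).eventually (gt_mem_nhds (zero_lt_one (α := ℝ)))
  obtain ⟨d₁, hd₁⟩ := Filter.eventually_atTop.mp h3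
  refine ⟨max d₁ 2, le_max_right _ _, fun d hd => ?_⟩
  have h4 := hd₁ d ((le_max_left _ _).trans hd)
  have hd1 : (1 : ℝ) ≤ d := by exact_mod_cast (by omega : 1 ≤ d)
  refine le_trans ?_ h4.le
  simp only [Function.comp]
  have e : 32 * ((2 : ℝ) ^ 39) ^ 6 * (((d : ℝ) / 2 ^ 39) ^ 6 * Real.exp (-((d : ℝ) / 2 ^ 39))) =
      32 * (d : ℝ) ^ 6 * Real.exp (-((d : ℝ) / 2 ^ 39)) := by
    field_simp
  rw [e]
  push_cast
  have h5 : (d : ℝ) ^ 2 + 1 ≤ 2 * d ^ 2 := by nlinarith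
  have h6 : (d : ℝ) + d * d ≤ 2 * d ^ 2 := by nlinarith
  have h7 : ((d : ℝ) + d * d) * (d + d * d) ≤ (2 * d ^ 2) * (2 * d ^ 2) :=
    mul_le_mul h6 h6 (by positivity) (by positivity)
  calc 4 * (((d : ℝ) ^ 2 + 1) * Real.exp (-(d / 2 ^ 39))) * ((d + d * d) * (d + d * d))
      = 4 * (((d : ℝ) ^ 2 + 1) * ((d + d * d) * (d + d * d))) * Real.exp (-(d / 2 ^ 39)) := by
        ring
    _ ≤ 4 * ((2 * d ^ 2) * ((2 * d ^ 2) * (2 * d ^ 2))) * Real.exp (-(d / 2 ^ 39)) := by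
        gcongr
    _ = _ := by ring

/-- Let `d` be large and let `G` have maximum degree at most `d`. If each vertex either has fewer
than `q` neighbours or has a neighbourhood that misses a positive proportion of the possible edges,
then `G` is `q`-colourable, provided `q` exceeds `(1 - 2⁻¹⁸) d`. -/
theorem exists_forall_colorable_of_sparse_neighborhoods : ∃ d₀ : ℕ,
    ∀ {V : Type*} [Fintype V] [DecidableEq V] (G : SimpleGraph V) [DecidableRel G.Adj] (d q : ℕ),
      d₀ ≤ d → q ≤ d → d ≤ 2 * q → (d : ℝ) - d / 2 ^ 18 < q → (∀ v, G.degree v ≤ d) →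
      (∀ v, G.degree v < q ∨ d ^ 2 ≤ 8 * #(nonadjPairs G v)) → G.Colorable q := by
  obtain ⟨d₀, hd₀2, hd₀⟩ := exists_forall_local_condition
  refine ⟨max d₀ 4, fun {V} _ _ G _ d q hdd hqd hd2 hdq hd hsparse => ?_⟩
  have hd4 : 4 ≤ d := (le_max_right _ _).trans hdd
  have hq : 2 ≤ q := by omega
  have : Nonempty (Fin q) := ⟨⟨0, by omega⟩⟩
  obtain ⟨σ, hσ⟩ := exists_notMem_of_local
    (A := fun v : V => {σ : V → Fin q | d ^ 2 ≤ 8 * #(nonadjPairs G v) ∧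
      (repeats G v σ : ℝ) < d / 2 ^ 18}) (scope G)
    ((d ^ 2 + 1) * Real.exp (-(d / 2 ^ 39))) ((d + d * d) * (d + d * d))
    (fun v σ τ h => by
      have := dependsOn_repeats v h
      simp only at this
      simp only [Set.mem_ofPred_eq, this])
    (fun v => by
      by_cases hv : d ^ 2 ≤ 8 * #(nonadjPairs G v)
      · exact (prob_mono fun σ h => h.2).trans (prob_repeats_lt_le hq hqd hd2 hd v hv)
      · have : {σ : V → Fin q | d ^ 2 ≤ 8 * #(nonadjPairs G v) ∧
            (repeats G v σ : ℝ) < d / 2 ^ 18} = ∅ := by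
          ext σ; simp [hv]
        rw [this]
        simp only [prob, Set.indicator_empty, expect_const_zero]
        positivity)
    (card_not_disjoint_scope_le hd) (by nlinarith) (hd₀ d ((le_max_left _ _).trans hdd))
  refine colorable_of_partial _ (kept G σ) σ rfl ?_ ?_
  · intro u hu w _ huw h
    exact (mem_filter.mp hu).2 w huw h.symm
  · intro v _
    have h1 := card_image_add_repeats_le (G := G) v σ
    have h2 := card_sdiff_add_card_inter (G.neighborFinset v) (kept G σ)
    rw [SimpleGraph.card_neighborFinset_eq_degree] at h2
    rcases hsparse v with hv | hv
    · omega
    · have h3 : ¬ (repeats G v σ : ℝ) < d / 2 ^ 18 := fun h => hσ v ⟨hv, h⟩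
      have h4 : #(G.neighborFinset v \ kept G σ) +
          #((G.neighborFinset v ∩ kept G σ).image σ) + repeats G v σ ≤ d := by
        have := hd v
        omega
      have h4' : (#(G.neighborFinset v \ kept G σ) +
          #((G.neighborFinset v ∩ kept G σ).image σ) : ℝ) + repeats G v σ ≤ d := by
        exact_mod_cast h4
      have h5 : (#(G.neighborFinset v \ kept G σ) +
          #((G.neighborFinset v ∩ kept G σ).image σ) : ℝ) < q := by linarith
      exact_mod_cast h5

end SparseColoring

/-! ### The conflict graph of a loopless multigraph -/

/-- A loopless multigraph on finite types, given by the two ends of each edge. The order of the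
ends carries no meaning. -/
structure LooplessMultigraph (V E : Type*) where
  /-- One end of an edge. -/
  src : E → V
  /-- The other end of an edge. -/
  tgt : E → V
  src_ne_tgt : ∀ e, src e ≠ tgt e

namespace LooplessMultigraph

variable {V E : Type*} [Fintype V] [DecidableEq V] [Fintype E] [DecidableEq E]
  (M : LooplessMultigraph V E)

/-- The vertex `v` is an end of the edge `e`. -/
def Inc (e : E) (v : V) : Prop := M.src e = v ∨ M.tgt e = v

instance (e : E) (v : V) : Decidable (M.Inc e v) := by unfold Inc; infer_instance

/-- Two different vertices are adjacent if an edge joins them. -/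
def Adj (u v : V) : Prop := u ≠ v ∧ ∃ e, M.Inc e u ∧ M.Inc e v

instance : DecidableRel M.Adj := fun u v => by unfold Adj; infer_instance

/-- The edges at a vertex. -/
def edgesAt (v : V) : Finset E := {e | M.Inc e v}

/-- The end of `e` other than `v`, if `v` is an end of `e`. -/
def other (v : V) (e : E) : V := if M.src e = v then M.tgt e else M.src e

/-- Two different edges are in conflict if some edge, possibly one of the two, shares an end with
both of them. -/
def conflict : SimpleGraph E where
  Adj e f := e ≠ f ∧ ∃ h, (∃ v, M.Inc e v ∧ M.Inc h v) ∧ ∃ w, M.Inc f w ∧ M.Inc h w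
  symm := ⟨fun _ _ ⟨hne, h, h₁, h₂⟩ => ⟨hne.symm, h, h₂, h₁⟩⟩
  loopless := ⟨fun _ h => h.1 rfl⟩

instance : DecidableRel M.conflict.Adj := fun e f => by
  unfold conflict; infer_instance

variable {M}

lemma mem_edgesAt {e : E} {v : V} : e ∈ M.edgesAt v ↔ M.Inc e v := by simp [edgesAt]

lemma Adj.symm {u v : V} (h : M.Adj u v) : M.Adj v u :=
  ⟨h.1.symm, h.2.imp fun _ h => ⟨h.2, h.1⟩⟩

lemma adj_comm {u v : V} : M.Adj u v ↔ M.Adj v u := ⟨Adj.symm, Adj.symm⟩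

lemma other_eq {e : E} {u v : V} (hu : M.Inc e u) (hv : M.Inc e v) (huv : u ≠ v) :
    M.other u e = v := by
  unfold other
  rcases hu with hu | hu <;> rcases hv with hv | hv
  · exact (huv (hu.symm.trans hv)).elim
  · rw [if_pos hu, hv]
  · rw [if_neg, hv]
    exact fun h => M.src_ne_tgt e (h.trans hu.symm)
  · exact (huv (hu.symm.trans hv)).elim

lemma inc_other (e : E) (v : V) : M.Inc e (M.other v e) := by
  unfold other
  split_ifs
  · exact Or.inr rfl
  · exact Or.inl rfl

lemma eq_or_eq_other {e : E} {u v : V} (hu : M.Inc e u) (hv : M.Inc e v) :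
    v = u ∨ v = M.other u e := by
  by_cases h : u = v
  · exact Or.inl h.symm
  · exact Or.inr (other_eq hu hv h).symm

lemma card_adj_le {D : ℕ} (hD : ∀ v, #(M.edgesAt v) ≤ D) (v : V) : #{u | M.Adj u v} ≤ D := by
  have h : ({u | M.Adj u v} : Finset V) ⊆ (M.edgesAt v).image (M.other v) := by
    intro u hu
    obtain ⟨hne, e, heu, hev⟩ := (mem_filter.mp hu).2
    exact mem_image.mpr ⟨e, mem_edgesAt.mpr hev, other_eq hev heu hne.symm⟩
  exact (card_le_card h).trans (card_image_le.trans (hD v))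

/-- The number of edges in conflict with a given edge. -/
lemma degree_conflict_le {D : ℕ} (hD : ∀ v, #(M.edgesAt v) ≤ D) (e : E) :
    M.conflict.degree e ≤ 2 * ((D - 1) * D) := by
  have hsub : M.conflict.neighborFinset e ⊆
      (((M.edgesAt (M.src e)).erase e).biUnion fun h => M.edgesAt (M.other (M.src e) h)) ∪
        ((M.edgesAt (M.tgt e)).erase e).biUnion fun h => M.edgesAt (M.other (M.tgt e) h) := by
    intro f hf
    obtain ⟨hne, h, ⟨v, hev, hhv⟩, w, hfw, hhw⟩ := (M.conflict.mem_neighborFinset e f).mp hf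
    -- An edge that shares an end `v` with `e` and is different from `e` leads to `f`.
    have key : ∀ v, M.Inc e v → M.Inc h v →
        f ∈ (((M.edgesAt v).erase e).biUnion fun h => M.edgesAt (M.other v h)) ∨ h = e := by
      intro v hev hhv
      by_cases hhe : h = e
      · exact Or.inr hhe
      · left
        rcases eq_or_eq_other hhv hhw with rfl | hw
        · exact mem_biUnion.mpr ⟨f, mem_erase.mpr ⟨hne.symm, mem_edgesAt.mpr hfw⟩,
            mem_edgesAt.mpr (inc_other _ _)⟩
        · exact mem_biUnion.mpr ⟨h, mem_erase.mpr ⟨hhe, mem_edgesAt.mpr hhv⟩,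
            mem_edgesAt.mpr (hw ▸ hfw)⟩
    have key2 : ∃ v, M.Inc e v ∧
        f ∈ ((M.edgesAt v).erase e).biUnion fun h => M.edgesAt (M.other v h) := by
      rcases key v hev hhv with h1 | rfl
      · exact ⟨v, hev, h1⟩
      · exact ⟨w, hhw, mem_biUnion.mpr ⟨f, mem_erase.mpr ⟨hne.symm, mem_edgesAt.mpr hfw⟩,
          mem_edgesAt.mpr (inc_other _ _)⟩⟩
    obtain ⟨v, rfl | rfl, hv⟩ := key2
    · exact mem_union_left _ hv
    · exact mem_union_right _ hv
  have hcard : ∀ v, M.Inc e v →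
      #(((M.edgesAt v).erase e).biUnion fun h => M.edgesAt (M.other v h)) ≤ (D - 1) * D := by
    intro v hv
    refine (card_biUnion_le_card_mul _ _ D fun h _ => hD _).trans (Nat.mul_le_mul_right _ ?_)
    rw [card_erase_of_mem (mem_edgesAt.mpr hv)]
    exact Nat.sub_le_sub_right (hD v) 1
  have h1 := hcard _ (Or.inl rfl)
  have h2 := hcard _ (Or.inr rfl)
  have h3 := (card_le_card hsub).trans (card_union_le _ _)
  rw [SimpleGraph.card_neighborFinset_eq_degree] at h3
  omega

section Bipartite

variable (M) (A B : Finset V)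

/-- The edges between `A` and `B`. -/
def between : Finset E :=
  {f | (M.src f ∈ A ∧ M.tgt f ∈ B) ∨ (M.tgt f ∈ A ∧ M.src f ∈ B)}

/-- The edges with both ends in `A`. -/
def inside : Finset E := {f | M.src f ∈ A ∧ M.tgt f ∈ A}

/-- The end in `A` of an edge between `A` and its complement. -/
def endIn (f : E) : V := if M.src f ∈ A then M.src f else M.tgt f

/-- The end outside `A` of an edge between `A` and its complement. -/
def endOut (f : E) : V := if M.src f ∈ A then M.tgt f else M.src f

/-- The number of edges from `b` to `A`. -/
def degIn (b : V) : ℕ := #{f ∈ M.between A B | M.endOut A f = b}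

/-- The number of neighbours of `b` in `A`. -/
def nbrsIn (b : V) : ℕ := #{a ∈ A | M.Adj a b}

/-- The number of neighbours of `b` in `B`. -/
def nbrsOut (b : V) : ℕ := #{b' ∈ B | M.Adj b b'}

variable {M A B}

lemma inc_endIn (f : E) : M.Inc f (M.endIn A f) := by
  unfold endIn; split_ifs
  · exact Or.inl rfl
  · exact Or.inr rfl

lemma inc_endOut (f : E) : M.Inc f (M.endOut A f) := by
  unfold endOut; split_ifs
  · exact Or.inr rfl
  · exact Or.inl rfl

lemma inc_iff (f : E) (v : V) : M.Inc f v ↔ v = M.endIn A f ∨ v = M.endOut A f := by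
  unfold endIn endOut Inc
  split_ifs
  · exact or_congr eq_comm eq_comm
  · rw [or_comm]; exact or_congr eq_comm eq_comm

lemma endIn_mem (hAB : Disjoint A B) {f : E} (hf : f ∈ M.between A B) : M.endIn A f ∈ A := by
  unfold endIn
  rcases (mem_filter.mp hf).2 with h | h
  · rw [if_pos h.1]; exact h.1
  · rw [if_neg (disjoint_right.mp hAB h.2)]; exact h.1

lemma endOut_mem (hAB : Disjoint A B) {f : E} (hf : f ∈ M.between A B) : M.endOut A f ∈ B := by
  unfold endOut
  rcases (mem_filter.mp hf).2 with h | h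
  · rw [if_pos h.1]; exact h.2
  · rw [if_neg (disjoint_right.mp hAB h.2)]; exact h.2

lemma mem_between_of_inc (hAB : Disjoint A B) {f : E} {a b : V} (ha : M.Inc f a) (hb : M.Inc f b)
    (haA : a ∈ A) (hbB : b ∈ B) :
    f ∈ M.between A B ∧ M.endIn A f = a ∧ M.endOut A f = b := by
  have hab : a ≠ b := fun h => disjoint_left.mp hAB haA (h ▸ hbB)
  have hmem : f ∈ M.between A B := by
    refine mem_filter.mpr ⟨mem_univ _, ?_⟩
    rcases ha with rfl | rfl <;> rcases hb with rfl | rfl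
    · exact (hab rfl).elim
    · exact Or.inl ⟨haA, hbB⟩
    · exact Or.inr ⟨haA, hbB⟩
    · exact (hab rfl).elim
  have h1 := (inc_iff (A := A) f a).mp ha
  have h2 := (inc_iff (A := A) f b).mp hb
  have h3 := endIn_mem hAB hmem
  have h4 := endOut_mem hAB hmem
  refine ⟨hmem, ?_, ?_⟩
  · rcases h1 with h1 | h1
    · exact h1.symm
    · exact (disjoint_left.mp hAB haA (h1 ▸ h4)).elim
  · rcases h2 with h2 | h2
    · exact (disjoint_right.mp hAB hbB (h2 ▸ h3)).elim
    · exact h2.symm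

lemma card_between_add_le (hAB : Disjoint A B) {D : ℕ} (hD : ∀ v, #(M.edgesAt v) ≤ D) :
    #(M.between A B) + 2 * #(M.inside A) ≤ #A * D := by
  have h1 : ∑ a ∈ A, #(M.edgesAt a) ≤ #A * D := sum_le_card_nsmul _ _ _ fun a _ => hD a
  refine le_trans ?_ h1
  have h2 : ∑ a ∈ A, #(M.edgesAt a) = ∑ f : E, #{a ∈ A | M.Inc f a} := by
    simp only [edgesAt, card_filter]
    exact sum_comm
  have hdisj : Disjoint (M.between A B) (M.inside A) := by
    rw [disjoint_left]
    intro f hf hf'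
    have h := (mem_filter.mp hf').2
    rcases (mem_filter.mp hf).2 with h' | h'
    · exact disjoint_left.mp hAB h.2 h'.2
    · exact disjoint_left.mp hAB h.1 h'.2
  rw [h2]
  calc #(M.between A B) + 2 * #(M.inside A)
      = ∑ f ∈ M.between A B, 1 + ∑ f ∈ M.inside A, 2 := by
        rw [sum_const, sum_const, smul_eq_mul, smul_eq_mul]; omega
    _ ≤ ∑ f ∈ M.between A B, #{a ∈ A | M.Inc f a} + ∑ f ∈ M.inside A, #{a ∈ A | M.Inc f a} := by
        refine Nat.add_le_add (sum_le_sum fun f hf => ?_) (sum_le_sum fun f hf => ?_)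
        · exact card_pos.mpr ⟨_, mem_filter.mpr ⟨endIn_mem hAB hf, inc_endIn f⟩⟩
        · rw [← card_pair (M.src_ne_tgt f)]
          have h := (mem_filter.mp hf).2
          refine card_le_card fun v hv => ?_
          rcases mem_insert.mp hv with rfl | hv
          · exact mem_filter.mpr ⟨h.1, Or.inl rfl⟩
          · rw [mem_singleton] at hv
            subst hv
            exact mem_filter.mpr ⟨h.2, Or.inr rfl⟩
    _ = ∑ f ∈ M.between A B ∪ M.inside A, #{a ∈ A | M.Inc f a} := (sum_union hdisj).symm
    _ ≤ _ := sum_le_sum_of_subset (subset_univ _)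

lemma degIn_add_nbrsOut_le (hAB : Disjoint A B) {D : ℕ} (hD : ∀ v, #(M.edgesAt v) ≤ D) (b : V) :
    M.degIn A B b + M.nbrsOut B b ≤ D := by
  have h1 : M.nbrsOut B b ≤ #{h ∈ M.edgesAt b | M.other b h ∈ B} := by
    refine le_trans (card_le_card ?_) (card_image_le (f := M.other b))
    intro b' hb'
    obtain ⟨hb'B, hne, e, he, he'⟩ := mem_filter.mp hb'
    have ho := other_eq he he' hne
    exact mem_image.mpr ⟨e, mem_filter.mpr ⟨mem_edgesAt.mpr he, ho ▸ hb'B⟩, ho⟩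
  have h2 : M.degIn A B b ≤ #{h ∈ M.edgesAt b | ¬ M.other b h ∈ B} := by
    refine card_le_card fun f hf => ?_
    obtain ⟨hfP, rfl⟩ := mem_filter.mp hf
    have hA := endIn_mem hAB hfP
    have hne : M.endOut A f ≠ M.endIn A f := fun h =>
      disjoint_left.mp hAB hA (h ▸ endOut_mem hAB hfP)
    refine mem_filter.mpr ⟨mem_edgesAt.mpr (inc_endOut f), ?_⟩
    rw [other_eq (inc_endOut f) (inc_endIn f) hne]
    exact disjoint_left.mp hAB hA
  have h3 := card_filter_add_card_filter_not (s := M.edgesAt b) (fun h => M.other b h ∈ B)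
  have h4 := hD b
  omega

lemma sum_endOut (hAB : Disjoint A B) (F : V → ℕ) :
    ∑ f ∈ M.between A B, F (M.endOut A f) = ∑ b ∈ B, M.degIn A B b * F b := by
  rw [← sum_fiberwise_of_maps_to (t := B) (g := M.endOut A) fun f hf => endOut_mem hAB hf]
  refine sum_congr rfl fun b _ => ?_
  rw [sum_congr rfl fun f hf => by rw [(mem_filter.mp hf).2], sum_const, smul_eq_mul, degIn]

variable (M A B) in
/-- The ordered pairs of edges between `A` and `B` whose ends are related by `r`. -/
def pairsWith (r : E → E → Prop) [DecidableRel r] : Finset (E × E) :=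
  {x ∈ M.between A B ×ˢ M.between A B | r x.1 x.2}

lemma card_pairsWith (r : E → E → Prop) [DecidableRel r] :
    #(M.pairsWith A B r) = ∑ f ∈ M.between A B, #{g ∈ M.between A B | r f g} := by
  rw [pairsWith, card_filter, sum_product]
  exact sum_congr rfl fun f _ => (card_filter _ _).symm

lemma card_pairs_endIn_eq_le {D : ℕ} (hD : ∀ v, #(M.edgesAt v) ≤ D) :
    #(M.pairsWith A B fun f g => M.endIn A f = M.endIn A g) ≤ #(M.between A B) * D := by
  rw [card_pairsWith]
  refine sum_le_card_nsmul _ _ _ fun f _ => le_trans (card_le_card fun g hg => ?_)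
    (hD (M.endIn A f))
  rw [(mem_filter.mp hg).2]
  exact mem_edgesAt.mpr (inc_endIn g)

lemma card_pairs_endOut_eq_le {D : ℕ} (hD : ∀ v, #(M.edgesAt v) ≤ D) :
    #(M.pairsWith A B fun f g => M.endOut A f = M.endOut A g) ≤ #(M.between A B) * D := by
  rw [card_pairsWith]
  refine sum_le_card_nsmul _ _ _ fun f _ => le_trans (card_le_card fun g hg => ?_)
    (hD (M.endOut A f))
  rw [(mem_filter.mp hg).2]
  exact mem_edgesAt.mpr (inc_endOut g)

lemma card_pairs_adj_endIn_le (hAB : Disjoint A B) {D : ℕ} (hD : ∀ v, #(M.edgesAt v) ≤ D) :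
    #(M.pairsWith A B fun f g => M.Adj (M.endIn A f) (M.endIn A g)) ≤
      D * D * (2 * #(M.inside A)) := by
  have h1 := card_le_mul_card_image_of_maps_to
    (s := M.pairsWith A B fun f g => M.Adj (M.endIn A f) (M.endIn A g))
    (t := {x ∈ A ×ˢ A | M.Adj x.1 x.2}) (f := fun x => (M.endIn A x.1, M.endIn A x.2))
    (fun x hx => by
      obtain ⟨hx, hadj⟩ := mem_filter.mp hx
      obtain ⟨hf, hg⟩ := mem_product.mp hx
      exact mem_filter.mpr ⟨mem_product.mpr ⟨endIn_mem hAB hf, endIn_mem hAB hg⟩, hadj⟩)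
    (D * D) (fun y _ => by
      have hsub : {x ∈ M.pairsWith A B fun f g => M.Adj (M.endIn A f) (M.endIn A g) |
          (M.endIn A x.1, M.endIn A x.2) = y} ⊆ M.edgesAt y.1 ×ˢ M.edgesAt y.2 := by
        intro x hx
        obtain ⟨-, rfl⟩ := mem_filter.mp hx
        exact mem_product.mpr ⟨mem_edgesAt.mpr (inc_endIn _), mem_edgesAt.mpr (inc_endIn _)⟩
      refine (card_le_card hsub).trans ?_
      rw [card_product]
      exact Nat.mul_le_mul (hD _) (hD _))
  refine h1.trans (Nat.mul_le_mul_left _ ?_)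
  have hsub : {x ∈ A ×ˢ A | M.Adj x.1 x.2} ⊆
      (M.inside A).image (fun f => (M.src f, M.tgt f)) ∪
        (M.inside A).image (fun f => (M.tgt f, M.src f)) := by
    rintro ⟨a, a'⟩ hx
    obtain ⟨hx, hne, f, hfa, hfa'⟩ := mem_filter.mp hx
    obtain ⟨ha, ha'⟩ := mem_product.mp hx
    simp only at hne hfa hfa' ha ha'
    rcases hfa with rfl | rfl <;> rcases hfa' with rfl | rfl
    · exact (hne rfl).elim
    · exact mem_union_left _ (mem_image.mpr ⟨f, mem_filter.mpr ⟨mem_univ _, ha, ha'⟩, rfl⟩)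
    · exact mem_union_right _ (mem_image.mpr ⟨f, mem_filter.mpr ⟨mem_univ _, ha', ha⟩, rfl⟩)
    · exact (hne rfl).elim
  refine (card_le_card hsub).trans ((card_union_le _ _).trans ?_)
  have h2 := card_image_le (s := M.inside A) (f := fun f => (M.src f, M.tgt f))
  have h3 := card_image_le (s := M.inside A) (f := fun f => (M.tgt f, M.src f))
  omega

lemma card_pairs_adj_endOut_le (hAB : Disjoint A B) :
    #(M.pairsWith A B fun f g => M.Adj (M.endOut A f) (M.endOut A g)) ≤
      ∑ b ∈ B, M.degIn A B b ^ 2 * M.nbrsOut B b := by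
  set s := M.degIn A B
  have h1 : #(M.pairsWith A B fun f g => M.Adj (M.endOut A f) (M.endOut A g)) =
      ∑ b ∈ B, ∑ b' ∈ B, if M.Adj b b' then s b * s b' else 0 := by
    rw [card_pairsWith, sum_endOut hAB fun b => #{g ∈ M.between A B | M.Adj b (M.endOut A g)}]
    refine sum_congr rfl fun b _ => ?_
    rw [card_filter, sum_endOut hAB fun b' => if M.Adj b b' then 1 else 0, mul_sum]
    refine sum_congr rfl fun b' _ => ?_
    split_ifs <;> simp [s]
  have h2 : ∑ b ∈ B, ∑ b' ∈ B, (if M.Adj b b' then s b ^ 2 else 0) =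
      ∑ b ∈ B, s b ^ 2 * M.nbrsOut B b := by
    refine sum_congr rfl fun b _ => ?_
    rw [nbrsOut, card_filter, mul_sum]
    refine sum_congr rfl fun b' _ => ?_
    split_ifs <;> simp
  have h3 : ∑ b ∈ B, ∑ b' ∈ B, (if M.Adj b b' then s b' ^ 2 else 0) =
      ∑ b ∈ B, s b ^ 2 * M.nbrsOut B b := by
    rw [← h2, sum_comm]
    refine sum_congr rfl fun b _ => sum_congr rfl fun b' _ => ?_
    simp only [adj_comm]
  have h4 : 2 * ∑ b ∈ B, ∑ b' ∈ B, (if M.Adj b b' then s b * s b' else 0) ≤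
      ∑ b ∈ B, ∑ b' ∈ B, (if M.Adj b b' then s b ^ 2 else 0) +
        ∑ b ∈ B, ∑ b' ∈ B, (if M.Adj b b' then s b' ^ 2 else 0) := by
    rw [mul_sum, ← sum_add_distrib]
    refine sum_le_sum fun b _ => ?_
    rw [mul_sum, ← sum_add_distrib]
    refine sum_le_sum fun b' _ => ?_
    split_ifs
    · have := two_mul_le_add_sq (s b) (s b')
      linarith
    · simp
  rw [h1]
  omega

lemma card_pairs_adj_endIn_endOut_le (hAB : Disjoint A B) {D : ℕ}
    (hD : ∀ v, #(M.edgesAt v) ≤ D) :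
    #(M.pairsWith A B fun f g => M.Adj (M.endIn A g) (M.endOut A f)) ≤
      ∑ b ∈ B, M.degIn A B b * (D * M.nbrsIn A b) := by
  rw [card_pairsWith, sum_endOut hAB fun b => #{g ∈ M.between A B | M.Adj (M.endIn A g) b}]
  refine sum_le_sum fun b _ => Nat.mul_le_mul_left _ ?_
  refine card_le_mul_card_image_of_maps_to (f := M.endIn A) (fun g hg => ?_) D fun a _ => ?_
  · obtain ⟨hg, hadj⟩ := mem_filter.mp hg
    exact mem_filter.mpr ⟨endIn_mem hAB hg, hadj⟩
  · refine le_trans (card_le_card fun g hg => ?_) (hD a)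
    obtain ⟨-, rfl⟩ := mem_filter.mp hg
    exact mem_edgesAt.mpr (inc_endIn g)

lemma card_pairsWith_swap (r : E → E → Prop) [DecidableRel r] :
    #(M.pairsWith A B fun f g => r g f) = #(M.pairsWith A B r) := by
  refine card_nbij' Prod.swap Prod.swap ?_ ?_ (fun _ _ => rfl) fun _ _ => rfl
  · intro x hx
    simp only [pairsWith, coe_filter, mem_product, Set.mem_ofPred_eq] at hx ⊢
    exact ⟨hx.1.symm, hx.2⟩
  · intro x hx
    simp only [pairsWith, coe_filter, mem_product, Set.mem_ofPred_eq] at hx ⊢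
    exact ⟨hx.1.symm, hx.2⟩

/-- There are many four-cycles `a b a' b'`, by convexity applied to the number of common neighbours
of `a` and `a'`; the pair of edges `ab`, `a'b'` of such a cycle is joined in two ways. -/
lemma sq_sum_nbrsIn_le (hAB : Disjoint A B) :
    (∑ b ∈ B, M.nbrsIn A b ^ 2) ^ 2 ≤ #A ^ 2 *
      #(M.pairsWith A B fun f g =>
        M.Adj (M.endIn A g) (M.endOut A f) ∧ M.Adj (M.endIn A f) (M.endOut A g)) := by
  let C : V × V → Finset V := fun x => {b ∈ B | M.Adj x.1 b ∧ M.Adj x.2 b}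
  have h1 : ∑ b ∈ B, M.nbrsIn A b ^ 2 = ∑ x ∈ A ×ˢ A, #(C x) := by
    simp only [C, card_filter]
    rw [sum_comm]
    refine sum_congr rfl fun b _ => ?_
    rw [nbrsIn, pow_two, ← card_product, ← filter_product, card_filter]
  have h2 : ∑ x ∈ A ×ˢ A, #(C x) ^ 2 ≤ #(M.pairsWith A B fun f g =>
      M.Adj (M.endIn A g) (M.endOut A f) ∧ M.Adj (M.endIn A f) (M.endOut A g)) := by
    have hcard : ∑ x ∈ A ×ˢ A, #(C x) ^ 2 = #((A ×ˢ A).sigma fun x => C x ×ˢ C x) := by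
      rw [card_sigma]
      exact sum_congr rfl fun x _ => by rw [card_product, pow_two]
    rw [hcard]
    refine le_trans (card_le_card ?_) (card_image_le (f := fun y : E × E =>
      (⟨(M.endIn A y.1, M.endIn A y.2), (M.endOut A y.1, M.endOut A y.2)⟩ :
        (_ : V × V) × (V × V))))
    rintro ⟨⟨a, a'⟩, ⟨b, b'⟩⟩ hx
    simp only [mem_sigma, mem_product, C, mem_filter] at hx
    obtain ⟨⟨ha, ha'⟩, ⟨hb, hab, ha'b⟩, hb', hab', ha'b'⟩ := hx
    obtain ⟨f, hfa, hfb⟩ := hab.2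
    obtain ⟨g, hga, hgb⟩ := ha'b'.2
    obtain ⟨hf, hfi, hfo⟩ := mem_between_of_inc hAB hfa hfb ha hb
    obtain ⟨hg, hgi, hgo⟩ := mem_between_of_inc hAB hga hgb ha' hb'
    refine mem_image.mpr ⟨(f, g), mem_filter.mpr ⟨mem_product.mpr ⟨hf, hg⟩, ?_⟩, ?_⟩
    · simp only [hfi, hfo, hgi, hgo]
      exact ⟨ha'b, hab'⟩
    · simp only [hfi, hfo, hgi, hgo]
  rw [h1]
  refine sq_sum_le_card_mul_sum_sq.trans ?_
  rw [card_product, ← pow_two]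
  exact Nat.mul_le_mul_left _ h2

/-- At most about three quarters of the pairs of edges between `A` and `B` are close, when `A` has
at most `2 D` vertices and spans few edges. -/
lemma card_pairs_close_le (hAB : Disjoint A B) {D : ℕ} (hD0 : 0 < D)
    (hD : ∀ v, #(M.edgesAt v) ≤ D) (hA : #A ≤ 2 * D) :
    (#(M.pairsWith A B fun f g => ∃ u v, M.Inc f u ∧ M.Inc g v ∧ (u = v ∨ M.Adj u v)) : ℝ) ≤
      2 * #(M.between A B) * D + 2 * #(M.inside A) * D ^ 2 + 3 * D ^ 4 := by
  set C₁ := M.pairsWith A B fun f g => M.endIn A f = M.endIn A g with hC₁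
  set C₂ := M.pairsWith A B fun f g => M.Adj (M.endIn A f) (M.endIn A g) with hC₂
  set C₃ := M.pairsWith A B fun f g => M.endOut A f = M.endOut A g with hC₃
  set C₄ := M.pairsWith A B fun f g => M.Adj (M.endOut A f) (M.endOut A g) with hC₄
  set C₅ := M.pairsWith A B fun f g => M.Adj (M.endIn A g) (M.endOut A f) with hC₅
  set C₆ := M.pairsWith A B fun f g => M.Adj (M.endIn A f) (M.endOut A g) with hC₆
  have hsub : (M.pairsWith A B fun f g =>
      ∃ u v, M.Inc f u ∧ M.Inc g v ∧ (u = v ∨ M.Adj u v)) ⊆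
      C₁ ∪ C₂ ∪ C₃ ∪ C₄ ∪ (C₅ ∪ C₆) := by
    rintro ⟨f, g⟩ hx
    obtain ⟨hx, u, v, hu, hv, huv⟩ := mem_filter.mp hx
    have hx' := mem_product.mp hx
    simp only at hu hv hx'
    have hne : M.endIn A f ≠ M.endOut A g := fun h =>
      disjoint_left.mp hAB (endIn_mem hAB hx'.1) (h ▸ endOut_mem hAB hx'.2)
    have hne' : M.endOut A f ≠ M.endIn A g := fun h =>
      disjoint_left.mp hAB (endIn_mem hAB hx'.2) (h ▸ endOut_mem hAB hx'.1)
    simp only [mem_union, hC₁, hC₂, hC₃, hC₄, hC₅, hC₆, pairsWith, mem_filter, hx, true_and]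
    rcases (inc_iff (A := A) f u).mp hu with rfl | rfl <;>
      rcases (inc_iff (A := A) g v).mp hv with rfl | rfl <;> rcases huv with huv | huv
    · tauto
    · tauto
    · exact (hne huv).elim
    · tauto
    · exact (hne' huv).elim
    · exact Or.inr (Or.inl huv.symm)
    · tauto
    · tauto
  have h0 := card_le_card hsub
  have h1 : #C₁ ≤ _ := card_pairs_endIn_eq_le hD
  have h2 : #C₂ ≤ _ := card_pairs_adj_endIn_le hAB hD
  have h3 : #C₃ ≤ _ := card_pairs_endOut_eq_le hD
  have h4 : #C₄ ≤ _ := card_pairs_adj_endOut_le hAB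
  have h5 : #C₅ ≤ _ := card_pairs_adj_endIn_endOut_le hAB hD
  have h6 : #C₆ = #C₅ := (card_pairsWith_swap _).symm
  have h56 := card_union_add_card_inter C₅ C₆
  have hinter : C₅ ∩ C₆ = M.pairsWith A B fun f g =>
      M.Adj (M.endIn A g) (M.endOut A f) ∧ M.Adj (M.endIn A f) (M.endOut A g) := by
    rw [hC₅, hC₆, pairsWith, pairsWith, pairsWith, filter_and]
  have h7 := sq_sum_nbrsIn_le (M := M) hAB
  rw [← hinter] at h7
  have hu : #(C₁ ∪ C₂ ∪ C₃ ∪ C₄ ∪ (C₅ ∪ C₆)) ≤ #C₁ + #C₂ + #C₃ + #C₄ + #(C₅ ∪ C₆) := by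
    have := card_union_le (C₁ ∪ C₂ ∪ C₃ ∪ C₄) (C₅ ∪ C₆)
    have := card_union_le (C₁ ∪ C₂ ∪ C₃) C₄
    have := card_union_le (C₁ ∪ C₂) C₃
    have := card_union_le C₁ C₂
    omega
  have hS : #(M.between A B) ≤ 2 * D * D := by
    have h := card_between_add_le (M := M) hAB hD
    have : #A * D ≤ 2 * D * D := Nat.mul_le_mul_right _ hA
    omega
  have hsumS : ∑ b ∈ B, M.degIn A B b = #(M.between A B) := by
    have := sum_endOut (M := M) hAB fun _ => 1
    simpa using this.symm
  have hDr : (0 : ℝ) < D := by exact_mod_cast hD0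
  set Q : ℝ := ∑ b ∈ B, (M.nbrsIn A b : ℝ) ^ 2 with hQ
  have g0 : (#(M.pairsWith A B fun f g =>
      ∃ u v, M.Inc f u ∧ M.Inc g v ∧ (u = v ∨ M.Adj u v)) : ℝ) + #(C₅ ∩ C₆) ≤
      #C₁ + #C₂ + #C₃ + #C₄ + 2 * #C₅ := by
    have : #(M.pairsWith A B fun f g =>
      ∃ u v, M.Inc f u ∧ M.Inc g v ∧ (u = v ∨ M.Adj u v)) + #(C₅ ∩ C₆) ≤
      #C₁ + #C₂ + #C₃ + #C₄ + 2 * #C₅ := by omega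
    exact_mod_cast this
  have g1 : (#C₁ : ℝ) ≤ #(M.between A B) * D := by exact_mod_cast h1
  have g2 : (#C₂ : ℝ) ≤ D * D * (2 * #(M.inside A)) := by exact_mod_cast h2
  have g3 : (#C₃ : ℝ) ≤ #(M.between A B) * D := by exact_mod_cast h3
  have g4 : (#C₄ : ℝ) ≤ ∑ b ∈ B, (M.degIn A B b : ℝ) ^ 2 * M.nbrsOut B b := by exact_mod_cast h4
  have g5 : (#C₅ : ℝ) ≤ ∑ b ∈ B, (M.degIn A B b : ℝ) * (D * M.nbrsIn A b) := by
    exact_mod_cast h5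
  have g7 : Q ^ 2 ≤ (2 * D) ^ 2 * #(C₅ ∩ C₆) := by
    have : Q ^ 2 ≤ (#A : ℝ) ^ 2 * #(C₅ ∩ C₆) := by rw [hQ]; exact_mod_cast h7
    refine this.trans (mul_le_mul_of_nonneg_right ?_ (Nat.cast_nonneg _))
    exact pow_le_pow_left₀ (Nat.cast_nonneg _) (by exact_mod_cast hA) 2
  have g8 : ∑ b ∈ B, (M.degIn A B b : ℝ) ^ 2 * M.nbrsOut B b +
      2 * ∑ b ∈ B, (M.degIn A B b : ℝ) * (D * M.nbrsIn A b) ≤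
      D ^ 2 * #(M.between A B) + D * Q := by
    rw [← hsumS, hQ, Nat.cast_sum, mul_sum, mul_sum, mul_sum, ← sum_add_distrib,
      ← sum_add_distrib]
    refine sum_le_sum fun b _ => ?_
    have hst : (M.degIn A B b : ℝ) + M.nbrsOut B b ≤ D := by
      exact_mod_cast degIn_add_nbrsOut_le hAB hD b
    -- The next bound is `2 D s n + s² (D - s) ≤ D² s + D n²`, as the difference of its two sides is
    -- `D (n - s)² + s (D - s)²`.
    set s : ℝ := (M.degIn A B b : ℝ)
    set t : ℝ := (M.nbrsOut B b : ℝ)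
    set n : ℝ := (M.nbrsIn A b : ℝ)
    have hs : 0 ≤ s := Nat.cast_nonneg _
    have e1 : s ^ 2 * t ≤ s ^ 2 * (D - s) :=
      mul_le_mul_of_nonneg_left (by linarith) (sq_nonneg s)
    have e2 : 0 ≤ D * (n - s) ^ 2 + s * (D - s) ^ 2 := by positivity
    nlinarith
  have gS : (#(M.between A B) : ℝ) ≤ 2 * D * D := by exact_mod_cast hS
  -- The sides differ by at least `(Q - 2 D³)² / (4 D²)`.
  have g9 : D * Q ≤ D ^ 4 + #(C₅ ∩ C₆) := by
    have e1 : 0 ≤ (Q - 2 * D ^ 3) ^ 2 := sq_nonneg _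
    have e2 : 4 * D ^ 2 * (D * Q) ≤ 4 * D ^ 2 * (D ^ 4 + #(C₅ ∩ C₆)) := by nlinarith
    exact le_of_mul_le_mul_left e2 (by positivity)
  have g10 : (D : ℝ) ^ 2 * #(M.between A B) ≤ D ^ 2 * (2 * D * D) :=
    mul_le_mul_of_nonneg_left gS (sq_nonneg _)
  have e : (D : ℝ) ^ 2 * (2 * D * D) = 2 * D ^ 4 := by ring
  nlinarith

end Bipartite

/-- If an edge is in conflict with almost `2 D²` edges, then a positive proportion of the pairs of
these edges are not in conflict. -/
lemma le_card_nonadjPairs_conflict {D : ℕ} (hD100 : 100 ≤ D) (hD : ∀ v, #(M.edgesAt v) ≤ D)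
    (e : E) (he : (2 - 1 / 50 : ℝ) * D ^ 2 ≤ M.conflict.degree e) :
    D ^ 4 ≤ 2 * #(SparseColoring.nonadjPairs M.conflict e) := by
  set x := M.src e
  set y := M.tgt e
  set A : Finset V := {a | a ≠ x ∧ a ≠ y ∧ (M.Adj a x ∨ M.Adj a y)}
  set B : Finset V := {b | b ≠ x ∧ b ≠ y ∧ b ∉ A}
  have hAB : Disjoint A B := by
    rw [disjoint_left]
    exact fun a ha hb => (mem_filter.mp hb).2.2.2 ha
  have hA : #A ≤ 2 * D := by
    have hsub : A ⊆ ({a | M.Adj a x} : Finset V) ∪ ({a | M.Adj a y} : Finset V) := by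
      intro a ha
      simpa using (mem_filter.mp ha).2.2.2
    have h1 := (card_le_card hsub).trans (card_union_le _ _)
    have h2 := card_adj_le hD x
    have h3 := card_adj_le hD y
    omega
  set P := M.between A B with hP
  set I := M.inside A with hI
  have hPI : #P + 2 * #I ≤ 2 * D * D :=
    (card_between_add_le hAB hD).trans (Nat.mul_le_mul_right _ hA)
  have hinc : ∀ {h v}, M.Inc e v → M.Inc h v → ∀ w, M.Inc h w → w = x ∨ w = y ∨ w ∈ A := by
    intro h v hev hhv w hhw
    by_cases hwx : w = x
    · exact Or.inl hwx
    by_cases hwy : w = y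
    · exact Or.inr (Or.inl hwy)
    refine Or.inr (Or.inr (mem_filter.mpr ⟨mem_univ _, hwx, hwy, ?_⟩))
    rcases hev with rfl | rfl
    · exact Or.inl ⟨hwx, h, hhw, hhv⟩
    · exact Or.inr ⟨hwy, h, hhw, hhv⟩
  have hN : M.conflict.neighborFinset e ⊆ P ∪ I ∪ (M.edgesAt x ∪ M.edgesAt y) := by
    intro f hf
    obtain ⟨hne, h, ⟨v, hev, hhv⟩, w, hfw, hhw⟩ := (M.conflict.mem_neighborFinset e f).mp hf
    by_cases hfx : M.Inc f x
    · exact mem_union_right _ (mem_union_left _ (mem_edgesAt.mpr hfx))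
    by_cases hfy : M.Inc f y
    · exact mem_union_right _ (mem_union_right _ (mem_edgesAt.mpr hfy))
    have hz : ∀ z, M.Inc f z → z ≠ x ∧ z ≠ y := fun z hz =>
      ⟨fun h => hfx (h ▸ hz), fun h => hfy (h ▸ hz)⟩
    have hwA : w ∈ A := by
      rcases hinc hev hhv w hhw with h | h | h
      · exact ((hz w hfw).1 h).elim
      · exact ((hz w hfw).2 h).elim
      · exact h
    refine mem_union_left _ ?_
    have hB : ∀ z, M.Inc f z → z ∉ A → z ∈ B := fun z hfz hzA =>
      mem_filter.mpr ⟨mem_univ _, (hz z hfz).1, (hz z hfz).2, hzA⟩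
    by_cases hall : M.src f ∈ A ∧ M.tgt f ∈ A
    · exact mem_union_right _ (mem_filter.mpr ⟨mem_univ _, hall⟩)
    · refine mem_union_left _ (mem_filter.mpr ⟨mem_univ _, ?_⟩)
      have h1 := hB (M.src f) (Or.inl rfl)
      have h2 := hB (M.tgt f) (Or.inr rfl)
      rcases hfw with rfl | rfl <;> tauto
  have hNcard : M.conflict.degree e ≤ #P + #I + 2 * D := by
    rw [← SimpleGraph.card_neighborFinset_eq_degree]
    have h1 := (card_le_card hN).trans (card_union_le _ _)
    have h2 := card_union_le P I
    have h3 := card_union_le (M.edgesAt x) (M.edgesAt y)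
    have h4 := hD x
    have h5 := hD y
    omega
  set R := M.pairsWith A B fun f g => ∃ u v, M.Inc f u ∧ M.Inc g v ∧ (u = v ∨ M.Adj u v) with hR
  have hclose : (#R : ℝ) ≤ 2 * #P * D + 2 * #I * D ^ 2 + 3 * D ^ 4 :=
    card_pairs_close_le hAB (by omega) hD hA
  have hPN : ∀ f ∈ P, f ∈ M.conflict.neighborFinset e := by
    intro f hf
    have ha := (mem_filter.mp (endIn_mem hAB hf)).2
    have hfa := inc_endIn (M := M) (A := A) f
    rw [SimpleGraph.mem_neighborFinset]
    refine ⟨?_, ?_⟩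
    · rintro rfl
      rcases hfa with h | h
      · exact ha.1 h.symm
      · exact ha.2.1 h.symm
    · rcases ha.2.2 with ⟨-, h, hha, hhx⟩ | ⟨-, h, hha, hhy⟩
      · exact ⟨h, ⟨x, Or.inl rfl, hhx⟩, _, hfa, hha⟩
      · exact ⟨h, ⟨y, Or.inr rfl, hhy⟩, _, hfa, hha⟩
  have hsub : (P ×ˢ P) \ R ⊆ SparseColoring.nonadjPairs M.conflict e := by
    rintro ⟨f, g⟩ hx
    obtain ⟨hx, hxR⟩ := mem_sdiff.mp hx
    obtain ⟨hf, hg⟩ := mem_product.mp hx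
    have hfar : ∀ u v, M.Inc f u → M.Inc g v → ¬ (u = v ∨ M.Adj u v) := fun u v hu hv huv =>
      hxR (mem_filter.mpr ⟨hx, u, v, hu, hv, huv⟩)
    refine mem_filter.mpr ⟨mem_product.mpr ⟨hPN f hf, hPN g hg⟩, ?_, ?_⟩
    · intro hfg
      exact hfar _ _ (Or.inl rfl) (Or.inl rfl) (Or.inl (congrArg M.src hfg))
    · rintro ⟨-, h, ⟨u, hfu, hhu⟩, v, hgv, hhv⟩
      refine hfar u v hfu hgv ?_
      by_cases huv : u = v
      · exact Or.inl huv
      · exact Or.inr ⟨huv, h, hhu, hhv⟩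
  have hcount : #P * #P ≤ #(SparseColoring.nonadjPairs M.conflict e) + #R := by
    have h1 := card_le_card hsub
    have h2 := le_card_sdiff R (P ×ˢ P)
    rw [card_product] at h2
    omega
  have k1 : (#P : ℝ) * #P ≤ #(SparseColoring.nonadjPairs M.conflict e) + #R := by
    exact_mod_cast hcount
  have k2 : (#P : ℝ) + 2 * #I ≤ 2 * D * D := by exact_mod_cast hPI
  have k3 : (M.conflict.degree e : ℝ) ≤ #P + #I + 2 * D := by exact_mod_cast hNcard
  have k4 : (100 : ℝ) ≤ D := by exact_mod_cast hD100
  have k5 : (D : ℝ) * 100 ≤ D ^ 2 := by nlinarith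
  -- The edges inside `A` are few, so almost all of the conflicting edges lie between `A` and `B`.
  have k6 : (#I : ℝ) ≤ 1 / 50 * D ^ 2 + 2 * D := by nlinarith
  have k7 : (2 - 2 / 50) * (D : ℝ) ^ 2 - 4 * D ≤ #P := by nlinarith
  have k8 : (192 / 100 : ℝ) * D ^ 2 ≤ #P := by nlinarith
  have k9 : (192 / 100 * D ^ 2 : ℝ) * (192 / 100 * D ^ 2) ≤ #P * #P :=
    mul_le_mul k8 k8 (by positivity) (Nat.cast_nonneg _)
  have k10 : (#I : ℝ) * D ^ 2 ≤ 4 / 100 * D ^ 2 * D ^ 2 :=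
    mul_le_mul_of_nonneg_right (by nlinarith) (by positivity)
  have k11 : (#P : ℝ) * D ≤ 2 / 100 * D ^ 2 * D ^ 2 := by
    have h1 : (#P : ℝ) * D ≤ (2 * D * D) * (D ^ 2 / 100) :=
      mul_le_mul (by linarith [Nat.cast_nonneg (α := ℝ) #I]) (by linarith) (by positivity)
        (by positivity)
    nlinarith
  have k12 : (D : ℝ) ^ 4 ≤ 2 * #(SparseColoring.nonadjPairs M.conflict e) := by
    nlinarith [sq_nonneg ((D : ℝ) ^ 2)]
  exact_mod_cast k12

end LooplessMultigraph

/-! ### Strong edge-colourings and squares of line graphs -/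

namespace LooplessMultigraph

lemma colorable_conflict {V E : Type*} [Fintype V] [DecidableEq V] [Fintype E] [DecidableEq E]
    {M : LooplessMultigraph V E} {D : ℕ} (hD : ∀ v, #(M.edgesAt v) ≤ D) :
    M.conflict.Colorable (2 * ((D - 1) * D) + 1) := by
  refine SparseColoring.colorable_of_partial _ ∅ (fun _ => 0) rfl (by simp) fun e _ => ?_
  have := degree_conflict_le hD e
  simp only [sdiff_empty, inter_empty, image_empty, card_empty,
    SimpleGraph.card_neighborFinset_eq_degree]
  omega

/-- For large `D`, a positive proportion of the colours of the greedy bound is saved. -/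
theorem exists_forall_conflict_colorable : ∃ D₀ : ℕ, ∀ {V E : Type*} [Fintype V] [DecidableEq V]
    [Fintype E] [DecidableEq E] (M : LooplessMultigraph V E) (D : ℕ), D₀ ≤ D →
      (∀ v, #(M.edgesAt v) ≤ D) →
        ∃ k : ℕ, M.conflict.Colorable k ∧ (k : ℝ) ≤ (2 - 1 / 2 ^ 19) * (D : ℝ) ^ 2 := by
  obtain ⟨d₀, hd₀⟩ := SparseColoring.exists_forall_colorable_of_sparse_neighborhoods
  refine ⟨max d₀ 1024, fun {V E} _ _ _ _ M D hD₀ hD => ?_⟩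
  have hDd₀ : d₀ ≤ D := (le_max_left _ _).trans hD₀
  have hD1 : 1024 ≤ D := (le_max_right _ _).trans hD₀
  set d := 2 * D ^ 2 with hd
  -- With `s` colours fewer than `d`, `q = d - s` lies above `(1 - 2⁻¹⁸) d`, and the rounding in `s`
  -- costs at most half of the saving `d / 2 ^ 19`.
  set s := d / 2 ^ 19 with hs
  have hDsq : 1024 * D ≤ D ^ 2 := by nlinarith
  have hsle : s ≤ d / 2 := Nat.div_le_div_left (by norm_num) (by norm_num)
  have hsr : (s : ℝ) ≤ d / 2 ^ 19 := by
    calc (s : ℝ) ≤ (d : ℝ) / ((2 ^ 19 : ℕ) : ℝ) := Nat.cast_div_le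
      _ = d / 2 ^ 19 := by norm_num
  have hsr' : (d : ℝ) / 2 ^ 19 < s + 1 := by
    have h1 : d < 2 ^ 19 * (s + 1) := Nat.lt_mul_div_succ d (by norm_num)
    have h2 : (d : ℝ) < 2 ^ 19 * (s + 1) := by exact_mod_cast h1
    rw [div_lt_iff₀ (by positivity)]
    linarith
  have hq : ((d - s : ℕ) : ℝ) = d - s := Nat.cast_sub (by omega)
  have hdr : (d : ℝ) = 2 * D ^ 2 := by rw [hd]; push_cast; ring
  have hDr : (1024 : ℝ) ≤ D := by exact_mod_cast hD1
  have hdbig : (2 : ℝ) ^ 20 ≤ d := by rw [hdr]; nlinarith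
  refine ⟨d - s, hd₀ M.conflict d (d - s) (by omega) (Nat.sub_le _ _) (by omega) ?_ ?_ ?_, ?_⟩
  · rw [hq]
    have : (d : ℝ) / 2 ^ 19 < d / 2 ^ 18 :=
      div_lt_div_of_pos_left (by linarith) (by norm_num) (by norm_num)
    linarith
  · intro e
    refine (degree_conflict_le hD e).trans ?_
    rw [hd, pow_two]
    exact Nat.mul_le_mul_left _ (Nat.mul_le_mul_right _ (Nat.sub_le _ _))
  · intro e
    by_cases he : M.conflict.degree e < d - s
    · exact Or.inl he
    · right
      have h1 : ((d - s : ℕ) : ℝ) ≤ M.conflict.degree e := by exact_mod_cast not_lt.mp he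
      have h2 := le_card_nonadjPairs_conflict (by omega) hD e (by
        rw [hq] at h1
        refine le_trans ?_ h1
        have : (d : ℝ) / 2 ^ 19 ≤ d / 100 :=
          div_le_div_of_nonneg_left (by linarith) (by norm_num) (by norm_num)
        rw [hdr] at this hsr ⊢
        linarith)
      rw [hd]
      have : (2 * D ^ 2) ^ 2 = 4 * D ^ 4 := by ring
      omega
  · rw [hq]
    have h1 : (d : ℝ) / 2 ^ 19 - 1 ≥ d / 2 ^ 20 := by
      have : (1 : ℝ) ≤ d / 2 ^ 20 := by rwa [le_div_iff₀ (by positivity), one_mul]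
      have e : (d : ℝ) / 2 ^ 19 = d / 2 ^ 20 + d / 2 ^ 20 := by ring
      linarith
    rw [hdr] at h1 hsr' ⊢
    linarith

end LooplessMultigraph

namespace Graph

variable {V E : Type*} (F : Graph V E)

lemma exists_ends (e : F.edgeSet) : ∃ p : F.vertexSet × F.vertexSet, F.IsLink e p.1 p.2 := by
  obtain ⟨x, y, h⟩ := F.exists_isLink_of_mem_edgeSet e.2
  exact ⟨(⟨x, h.left_mem⟩, ⟨y, h.right_mem⟩), h⟩

/-- The ends of an edge in some order; both entries agree for a loop. -/
noncomputable def ends (e : F.edgeSet) : F.vertexSet × F.vertexSet := (F.exists_ends e).choose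

lemma isLink_ends (e : F.edgeSet) : F.IsLink e (F.ends e).1 (F.ends e).2 :=
  (F.exists_ends e).choose_spec

open scoped Classical in
/-- The loopless multigraph in which every loop is replaced by an edge to a new vertex of its own.
Two edges share an end in it exactly when they do in the original multigraph. -/
noncomputable def unloop : LooplessMultigraph (F.vertexSet ⊕ F.edgeSet) F.edgeSet where
  src e := Sum.inl (F.ends e).1
  tgt e := if (F.ends e).1 = (F.ends e).2 then Sum.inr e else Sum.inl (F.ends e).2
  src_ne_tgt e := by
    split_ifs with h
    · simp
    · simpa using h

variable {F}

lemma unloop_inc_inl {e : F.edgeSet} {v : F.vertexSet} :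
    F.unloop.Inc e (Sum.inl v) ↔ F.Inc e v := by
  have h := F.isLink_ends e
  constructor
  · rintro (hv | hv)
    · simp only [unloop, Sum.inl.injEq] at hv
      exact hv ▸ h.inc_left
    · simp only [unloop] at hv
      split_ifs at hv
      rw [Sum.inl.injEq] at hv
      exact hv ▸ h.inc_right
  · intro hv
    by_cases h1 : (F.ends e).1 = v
    · exact Or.inl (congrArg Sum.inl h1)
    · have h2 : (F.ends e).2 = v := by
        rcases hv.eq_or_eq_of_isLink h with h' | h'
        · exact (h1 (Subtype.ext h'.symm)).elim
        · exact Subtype.ext h'.symm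
      right
      simp only [unloop]
      rw [if_neg (fun h' => h1 (h'.trans h2)), h2]

lemma unloop_inc_inr {e f : F.edgeSet} (h : F.unloop.Inc e (Sum.inr f)) : e = f := by
  rcases h with h | h
  · simp [unloop] at h
  · simp only [unloop] at h
    split_ifs at h
    exact Sum.inr.inj h

lemma edgesMeet_self (e : F.edgeSet) : F.EdgesMeet e e :=
  ⟨_, (F.isLink_ends e).inc_left, (F.isLink_ends e).inc_left⟩

lemma exists_unloop_inc_iff {e f : F.edgeSet} :
    (∃ v, F.unloop.Inc e v ∧ F.unloop.Inc f v) ↔ F.EdgesMeet e f := by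
  constructor
  · rintro ⟨v | g, he, hf⟩
    · exact ⟨v, unloop_inc_inl.mp he, unloop_inc_inl.mp hf⟩
    · rw [unloop_inc_inr he, unloop_inc_inr hf]
      exact edgesMeet_self g
  · rintro ⟨v, he, hf⟩
    exact ⟨Sum.inl ⟨v, he.vertex_mem⟩, unloop_inc_inl.mpr he, unloop_inc_inl.mpr hf⟩

lemma unloop_conflict_adj {e f : F.edgeSet} :
    F.unloop.conflict.Adj e f ↔ e ≠ f ∧ ∃ h : F.edgeSet, F.EdgesMeet e h ∧ F.EdgesMeet f h := by
  simp only [LooplessMultigraph.conflict, exists_unloop_inc_iff]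

lemma card_edgesAt_unloop_le [Fintype F.vertexSet] [DecidableEq (F.vertexSet ⊕ F.edgeSet)]
    [Fintype F.edgeSet] {D : ℕ}
    (hD : ∀ v, (F.incidenceSet v).ncard ≤ D)
    (v : F.vertexSet ⊕ F.edgeSet) : #(F.unloop.edgesAt v) ≤ D := by
  classical
  have hfin : ∀ v, (F.incidenceSet v).Finite := fun v =>
    (Set.toFinite F.edgeSet).subset (F.incidenceSet_subset_edgeSet v)
  rcases v with v | e
  · refine le_trans ?_ (hD v)
    rw [← card_map (Function.Embedding.subtype (· ∈ F.edgeSet)), ← Set.ncard_coe_finset]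
    refine Set.ncard_le_ncard ?_ (hfin v)
    intro e he
    obtain ⟨e', he', rfl⟩ := mem_map.mp (mem_coe.mp he)
    exact unloop_inc_inl.mp (LooplessMultigraph.mem_edgesAt.mp he')
  · -- The new vertex of a loop has degree one, which is at most `D` since there is an edge.
    have h1 : F.unloop.edgesAt (Sum.inr e) ⊆ {e} := fun f hf =>
      mem_singleton.mpr (unloop_inc_inr (LooplessMultigraph.mem_edgesAt.mp hf))
    refine (card_le_card h1).trans (le_trans ?_ (hD (F.ends e).1))
    rw [card_singleton, Nat.one_le_iff_ne_zero, ← Nat.pos_iff_ne_zero, Set.ncard_pos (hfin _)]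
    exact ⟨e, (F.isLink_ends e).inc_left⟩

lemma ncard_incidenceSet_le_maxDegree (hV : F.vertexSet.Finite) (v : V) :
    (F.incidenceSet v).ncard ≤ F.maxDegree := by
  by_cases hv : v ∈ F.vertexSet
  · refine (Nat.le_add_right _ (F.loopSet v).ncard).trans ?_
    exact le_csSup (hV.image _).bddAbove (Set.mem_image_of_mem _ hv)
  · have : F.incidenceSet v = ∅ :=
      Set.eq_empty_of_forall_notMem fun e he => hv (Inc.vertex_mem he)
    simp [this]

lemma isStrongEdgeColoring_of_conflict {C : Type*} (c : F.unloop.conflict.Coloring C) :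
    F.IsStrongEdgeColoring c := by
  refine ⟨fun e f hne h => c.valid (unloop_conflict_adj.mpr ⟨hne, f, h, edgesMeet_self f⟩), ?_⟩
  rintro e f hne ⟨x, y, hx, hy, g, hg⟩
  exact c.valid (unloop_conflict_adj.mpr ⟨hne, ⟨g, hg.edge_mem⟩, ⟨x, hx, hg.inc_left⟩,
    y, hy, hg.inc_right⟩)

lemma exists_strongChromaticIndex_eq {k : ℕ} (h : F.unloop.conflict.Colorable k) :
    ∃ m : ℕ, F.strongChromaticIndex = m ∧ m ≤ k := by
  obtain ⟨c⟩ := h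
  have hle : F.strongChromaticIndex ≤ k :=
    iInf₂_le (f := fun (k : ℕ) (_ : k ∈ {k : ℕ | ∃ c : F.edgeSet → Fin k,
      F.IsStrongEdgeColoring c}) => (k : ℕ∞)) k ⟨c, isStrongEdgeColoring_of_conflict c⟩
  obtain ⟨m, hm⟩ := ENat.ne_top_iff_exists.mp (ne_top_of_le_ne_top (ENat.natCast_ne_top k) hle)
  refine ⟨m, hm.symm, ?_⟩
  rw [← hm] at hle
  exact_mod_cast hle

lemma ncard_incidenceSet_le_cliqueNum {W : Type*} [Finite W] {G : SimpleGraph W}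
    (φ : G ≃g F.lineGraph) (v : V) : (F.incidenceSet v).ncard ≤ G.cliqueNum := by
  classical
  have := Fintype.ofFinite W
  set t : Finset W := {w | F.Inc (φ w) v}
  have ht : G.IsClique t := by
    intro u hu w hw huw
    rw [← φ.map_adj_iff]
    exact ⟨fun h => huw (φ.injective h), v, (mem_filter.mp hu).2, (mem_filter.mp hw).2⟩
  refine le_trans ?_ (SimpleGraph.IsClique.card_le_cliqueNum (tc := ht))
  have hsub : F.incidenceSet v ⊆ (t.image fun w => (φ w : E) : Finset E) := by
    intro e he
    have he' : F.Inc e v := he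
    refine mem_coe.mpr (mem_image.mpr ⟨φ.symm ⟨e, he'.edge_mem⟩, ?_, ?_⟩)
    · simp [t, he']
    · simp
  refine (Set.ncard_le_ncard hsub (finite_toSet _)).trans ?_
  rw [Set.ncard_coe_finset]
  exact card_image_le

lemma square_colorable {W : Type*} {G : SimpleGraph W} (φ : G ≃g F.lineGraph) {k : ℕ}
    (h : F.unloop.conflict.Colorable k) : G.square.Colorable k := by
  refine h.of_hom (⟨φ, ?_⟩ : G.square →g F.unloop.conflict)
  rintro u w ⟨hne, huw⟩
  refine unloop_conflict_adj.mpr ⟨fun h => hne (φ.injective h), ?_⟩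
  rcases huw with huw | ⟨x, hux, hxw⟩
  · obtain ⟨-, h⟩ := φ.map_adj_iff.mpr huw
    exact ⟨φ w, h, edgesMeet_self _⟩
  · obtain ⟨-, h⟩ := φ.map_adj_iff.mpr hux
    obtain ⟨-, h'⟩ := φ.map_adj_iff.mpr hxw.symm
    exact ⟨φ x, h, h'⟩

end Graph

theorem mainTheorem4 :
    (∃ ε : ℝ, 0 < ε ∧ ∃ Δ₀ : ℕ, ∀ (V E : Type*) (F : Graph V E),
      F.vertexSet.Finite → F.edgeSet.Finite → Δ₀ ≤ F.maxDegree →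
        ∃ k : ℕ, F.strongChromaticIndex = k ∧ (k : ℝ) ≤ (2 - ε) * (F.maxDegree : ℝ) ^ 2) ∧
    (∃ ε : ℝ, 0 < ε ∧ ∀ (V E W : Type*) (F : Graph V E) (G : SimpleGraph W),
      F.vertexSet.Finite → F.edgeSet.Finite → Nonempty (G ≃g F.lineGraph) →
        ∃ k : ℕ, G.square.chromaticNumber = k ∧ (k : ℝ) ≤ (2 - ε) * (G.cliqueNum : ℝ) ^ 2) := by
  classical
  constructor
  · obtain ⟨D₀, hD₀⟩ := LooplessMultigraph.exists_forall_conflict_colorable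
    refine ⟨1 / 2 ^ 19, by positivity, D₀, fun V E F hV hE hD => ?_⟩
    have := hV.fintype
    have := hE.fintype
    obtain ⟨k, hk, hkD⟩ := hD₀ F.unloop F.maxDegree hD
      (Graph.card_edgesAt_unloop_le (Graph.ncard_incidenceSet_le_maxDegree hV))
    obtain ⟨m, hm, hmk⟩ := Graph.exists_strongChromaticIndex_eq hk
    exact ⟨m, hm, le_trans (by exact_mod_cast hmk) hkD⟩
  · obtain ⟨D₀, hD₀⟩ := LooplessMultigraph.exists_forall_conflict_colorable
    refine ⟨min (1 / 2 ^ 19) (1 / ((D₀ : ℝ) + 1)), by positivity, fun V E W F G hV hE ⟨φ⟩ => ?_⟩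
    have := hV.fintype
    have := hE.fintype
    have : Finite W := Finite.of_equiv _ φ.symm.toEquiv
    have hω := Graph.card_edgesAt_unloop_le (Graph.ncard_incidenceSet_le_cliqueNum φ)
    suffices h : ∃ k : ℕ, F.unloop.conflict.Colorable k ∧
        (k : ℝ) ≤ (2 - min (1 / 2 ^ 19) (1 / ((D₀ : ℝ) + 1))) * (G.cliqueNum : ℝ) ^ 2 by
      obtain ⟨k, hk, hkω⟩ := h
      have hle := (Graph.square_colorable φ hk).chromaticNumber_le
      obtain ⟨m, hm⟩ := ENat.ne_top_iff_exists.mp (ne_top_of_le_ne_top (ENat.natCast_ne_top k) hle)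
      rw [← hm] at hle
      have hmk : m ≤ k := by exact_mod_cast hle
      exact ⟨m, hm.symm, le_trans (by exact_mod_cast hmk) hkω⟩
    set ω := G.cliqueNum
    rcases le_or_gt D₀ ω with hD | hD
    · obtain ⟨k, hk, hkω⟩ := hD₀ F.unloop ω hD hω
      refine ⟨k, hk, hkω.trans (mul_le_mul_of_nonneg_right ?_ (sq_nonneg _))⟩
      exact sub_le_sub_left (min_le_left _ _) _
    · rcases Nat.eq_zero_or_pos ω with h0 | h0
      · -- Clique number zero: there are no edges, and no colours are needed.
        have hE0 : IsEmpty F.edgeSet := ⟨fun e => by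
          have h1 := hω (F.unloop.src e)
          rw [h0, Nat.le_zero, card_eq_zero] at h1
          have h2 : e ∈ F.unloop.edgesAt (F.unloop.src e) :=
            LooplessMultigraph.mem_edgesAt.mpr (Or.inl rfl)
          rw [h1] at h2
          exact notMem_empty _ h2⟩
        exact ⟨0, SimpleGraph.colorable_zero_iff.mpr hE0, by simp [h0]⟩
      · -- For bounded clique number the greedy bound `2 ω² - 2 ω + 1` suffices.
        refine ⟨_, LooplessMultigraph.colorable_conflict hω, ?_⟩
        have h1 : (1 : ℝ) ≤ ω := by exact_mod_cast h0
        have h2 : (ω : ℝ) ≤ D₀ + 1 := by exact_mod_cast (by omega : ω ≤ D₀ + 1)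
        have h3 : min (1 / 2 ^ 19) (1 / ((D₀ : ℝ) + 1)) * (ω : ℝ) ≤ 1 := by
          calc min (1 / 2 ^ 19) (1 / ((D₀ : ℝ) + 1)) * (ω : ℝ) ≤ 1 / ((D₀ : ℝ) + 1) * (D₀ + 1) :=
                mul_le_mul (min_le_right _ _) h2 (by positivity) (by positivity)
            _ = 1 := by field_simp
        push_cast [Nat.cast_sub (show 1 ≤ ω from h0)]
        nlinarith
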